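/- Let $\mathbb T^2=\mathbb R^2/\mathbb Z^2$, identified with $[-\frac12,\frac12)^2$ with periodic boundary conditions. Let $G$ be its Green function, i.e. the zero-mean solution of $-\Delta G=\delta_0-1$ (equivalently $G=\int_0^\infty (p_t-1)\,dt$ with $p_t$ the heat kernel of $\mathbb T^2$). Write $\nabla^\perp=(\partial_2,-\partial_1)$ and let $K$ be the Biot–Savart kernel for the vorticity $\omega=\nabla^\perp\cdot v$, i.e. $K=-\nabla^\perp G=(-\partial_2G,\partial_1G)$, so that $v=K*\omega$ is divergence free and $\nabla^\perp\cdot v=\omega-\int_{\mathbb T^2}\omega\,dx$. Let $\theta,\chi\in C_c^\infty\big((-\frac12,\frac12)^2\big)$ be radially symmetric probability density functions, let $\kappa>0$, and let $(\gamma_\ell)_\ell$ be real numbers. For $\ell\in(0,1)$ put $\theta_\ell(x)=\ell^{-2}\theta(\ell^{-1}x)$, $\chi_\ell(x)=\ell^{-2}\chi(\ell^{-1}x)$, $$\Gamma_\ell=2\sqrt\kappa\,\|K*\theta_\ell\|_{L^2(\mathbb T^2)}^{-1},\qquad \sigma_H^\ell=\Gamma_\ell\,K*\theta_\ell,\qquad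 \sigma_3^\ell=\gamma_\ell\,G*\chi_\ell,\qquad \sigma^\ell=(\sigma_H^\ell,\sigma_3^\ell):\mathbb T^2\to\mathbb R^3,$$ and define the covariance function $$Q^\ell(a)=\int_{\mathbb T^2}\sigma^\ell(a-w)\otimes\sigma^\ell(-w)\,dw=\begin{pmatrix}Q_H^\ell(a)&Q_{H,3}^\ell(a)\\ Q_{3,H}^\ell(a)&Q_3^\ell(a)\end{pmatrix},\qquad \nabla Q_{H,3}^\ell(0)=\big(\partial_jQ_{i,3}^\ell(0)\big)_{i,j=1,2}.$$ Then, for every $\ell\in(0,1)$, $\Gamma_\ell$ is well defined and positive, $Q_H^\ell(0)=2\kappa I_2$, and $Q_{H,3}^\ell$ and $Q_3^\ell$ are of class $C^\infty$. Moreover: 1. If $\gamma_\ell=o(\Gamma_\ell)$ as $\ell\to0^+$, then $A:=\lim_{\ell\to0^+}\nabla Q_{H,3}^\ell(0)$ exists and $A=0$. 2. If $\gamma_\ell/\Gamma_\ell\to q_0\neq0$ as $\ell\to0^+$, then the limit $A=\lim_{\ell\to0^+}\nabla Q_{H,3}^\ell(0)$ exists and $$A=2\kappa q_0\begin{pmatrix}0&1\\-1&0\end{pmatrix}.$$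 3. Let $\|\cdot\|_M$ be any norm (or seminorm) on the real $2\times2$ matrices. If $\gamma_\ell=O(\Gamma_\ell)$ as $\ell\to0^+$, then $\sup_{\ell\in(0,\delta)}\|\nabla^2Q_3^\ell(0)\|_M<+\infty$ for some $\delta\in(0,1)$. If in addition $\gamma_\ell$ is bounded on $[\delta,1)$ for every $\delta\in(0,1)$, then $\sup_{\ell\in(0,1)}\|\nabla^2Q_3^\ell(0)\|_M<+\infty$. -/

import Mathlib

open Filter Topology MeasureTheory Asymptotics
open scoped ContDiff

noncomputable section

namespace VortexNoise

/-- The Euclidean plane. Functions on the torus `ℝ² / ℤ²` are treated as `ℤ²`-periodic functions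
on the plane, and integrated over the fundamental cell. -/
abbrev Plane : Type := EuclideanSpace ℝ (Fin 2)

/-- The fundamental cell `[-1/2, 1/2)²` of the torus `ℝ² / ℤ²`. -/
def cell : Set Plane := {x | ∀ i, x i ∈ Set.Ico (-(1 / 2) : ℝ) (1 / 2)}

/-- The partial derivative `∂ᵢ f (x)`. -/
def pderiv (i : Fin 2) (f : Plane → ℝ) (x : Plane) : ℝ :=
  lineDeriv ℝ f x (EuclideanSpace.single i 1)

/-- The convolution `(f ∗ g)(x) = ∫ f(x - y) g(y) dy` on the torus, where `f` is periodic and `g`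
is given by its values on the fundamental cell. -/
def torusConv (f g : Plane → ℝ) (x : Plane) : ℝ :=
  ∫ y in cell, f (x - y) * g y

/-- The heat kernel (for `∂ₜ - ∂ₛ²`) of the circle `ℝ / ℤ` at time `t`. -/
def circleHeatKernel (t s : ℝ) : ℝ :=
  ∑' n : ℤ, (√(4 * Real.pi * t))⁻¹ * Real.exp (-(s - n) ^ 2 / (4 * t))

/-- The heat kernel (for `∂ₜ - Δ`) of the torus `ℝ² / ℤ²` at time `t`. -/
def heatKernel (t : ℝ) (x : Plane) : ℝ :=
  ∏ i, circleHeatKernel t (x i)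

/-- The Green function of the torus: the zero-mean solution of `-Δ G = δ₀ - 1`, which is
`G = ∫₀^∞ (pₜ - 1) dt` for the heat kernel `pₜ`. The value at the lattice points, where `G = +∞`,
is irrelevant. -/
def green (x : Plane) : ℝ :=
  ∫ t in Set.Ioi (0 : ℝ), (heatKernel t x - 1)

/-- The Biot-Savart kernel `K = -∇^⊥ G = (-∂₂ G, ∂₁ G)` of the torus, for
`∇^⊥ = (∂₂, -∂₁)` and vorticity `ω = ∇^⊥ · v`: the field `v = K ∗ ω` is divergence free and
`∇^⊥ · v = ω - ∫ ω`. -/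
def biotSavart : Fin 2 → Plane → ℝ :=
  ![fun x => -pderiv 1 green x, fun x => pderiv 0 green x]

/-- Smooth radially symmetric probability densities with compact support in `(-1/2, 1/2)²`. -/
structure IsRadialDensity (θ : Plane → ℝ) : Prop where
  smooth : ContDiff ℝ ∞ θ
  compact_support : HasCompactSupport θ
  support_subset : tsupport θ ⊆ {x | ∀ i, x i ∈ Set.Ioo (-(1 / 2) : ℝ) (1 / 2)}
  nonneg : ∀ x, 0 ≤ θ x
  integral_eq_one : ∫ x, θ x = 1
  radial : ∀ x y, ‖x‖ = ‖y‖ → θ x = θ y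

/-- The rescaled density `θ_ℓ(x) = ℓ⁻² θ(ℓ⁻¹ x)`. -/
def rescale (l : ℝ) (θ : Plane → ℝ) (x : Plane) : ℝ :=
  (l ^ 2)⁻¹ * θ (l⁻¹ • x)

/-- The `L²` norm on the torus of `K ∗ θ`. -/
def velocityNorm (θ : Plane → ℝ) : ℝ :=
  √(∫ x in cell, ∑ i, torusConv (biotSavart i) θ x ^ 2)

/-- The horizontal intensity `Γ_ℓ = 2 √κ / ‖K ∗ θ_ℓ‖_{L²}`. -/
def intensity (κ : ℝ) (θ : Plane → ℝ) (l : ℝ) : ℝ :=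
  2 * √κ * (velocityNorm (rescale l θ))⁻¹

/-- The velocity field `σ^ℓ` of the vortex of size `ℓ`, with horizontal part
`σ_H^ℓ = Γ_ℓ K ∗ θ_ℓ` and vertical component `σ₃^ℓ = γ_ℓ G ∗ χ_ℓ`. -/
def vortex (κ : ℝ) (θ χ : Plane → ℝ) (γ : ℝ → ℝ) (l : ℝ) (x : Plane) : Fin 3 → ℝ :=
  ![intensity κ θ l * torusConv (biotSavart 0) (rescale l θ) x,
    intensity κ θ l * torusConv (biotSavart 1) (rescale l θ) x,
    γ l * torusConv green (rescale l χ) x]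

/-- The covariance function `Q(a) = ∫ σ(a - w) ⊗ σ(-w) dw` of a field `σ` on the torus. -/
def covariance (σ : Plane → Fin 3 → ℝ) (a : Plane) : Matrix (Fin 3) (Fin 3) ℝ :=
  Matrix.of fun i j => ∫ w in cell, σ (a - w) i * σ (-w) j

/-- The horizontal block `Q_H`. -/
def covH (σ : Plane → Fin 3 → ℝ) (a : Plane) : Matrix (Fin 2) (Fin 2) ℝ :=
  Matrix.of fun i j => covariance σ a i.castSucc j.castSucc

/-- The block `Q_{H,3}`. -/
def covH3 (σ : Plane → Fin 3 → ℝ) (i : Fin 2) (a : Plane) : ℝ :=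
  covariance σ a i.castSucc 2

/-- The entry `Q₃`. -/
def cov3 (σ : Plane → Fin 3 → ℝ) (a : Plane) : ℝ :=
  covariance σ a 2 2

/-- The matrix `∇ Q_{H,3}(0)`, with entry `∂ⱼ Q_{i,3}(0)` in row `i` and column `j`. -/
def gradCovH3 (σ : Plane → Fin 3 → ℝ) : Matrix (Fin 2) (Fin 2) ℝ :=
  Matrix.of fun i j => pderiv j (covH3 σ i) 0

/-- The Hessian matrix `∇² Q₃(0)`. -/
def hessCov3 (σ : Plane → Fin 3 → ℝ) : Matrix (Fin 2) (Fin 2) ℝ :=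
  Matrix.of fun i j => pderiv i (pderiv j (cov3 σ)) 0

end VortexNoise

end

open VortexNoise

noncomputable section

namespace VortexNoise

/-! Put u = G ∗ θ_ℓ and v = G ∗ χ_ℓ. Moving the derivative of G onto the smooth density gives σ_H =
Γ(−∂₂u, ∂₁u). Write E(φ, ψ) = ∫ φ (G ∗ ψ) for the Green energy. Three facts reduce every covariance
quantity to energies: −Δu = θ_ℓ − 1 on the cell; v has mean zero; u and v inherit the symmetries of
the square lattice. Reflection kills ∫ ∂₁∂₂u · v, exchange of coordinates makes the two integrals ∫
∂ᵢ²u · v equal, and their sum is ∫ (1 − θ_ℓ) v = −E(θ_ℓ, χ_ℓ). Hence ∫ ∂ⱼ∂ᵢu · v = −δᵢⱼ E(θ_ℓ,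
χ_ℓ)/2 (`setIntegral_mixed`, `setIntegral_pure`).

Integrating by parts, ‖K ∗ θ_ℓ‖² = E(θ_ℓ, θ_ℓ), so Γ² = 4κ/E(θ_ℓ, θ_ℓ). Then Q_H(0) = 2κI, the
gradient is exactly 2κ (γ/Γ) · E(θ_ℓ, χ_ℓ)/E(θ_ℓ, θ_ℓ) times the rotation matrix (`gradCovH3_eq`),
and the Hessian of Q₃ at 0 is −γ² E(χ_ℓ, χ_ℓ)/2 times the identity (`hessCov3_eq`).

The asymptotic input is E(θ_ℓ, χ_ℓ) = (2π)⁻¹ log(1/ℓ) + O(1), whatever the two densities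
(`exists_energy_sub_log_le`); so energy ratios tend to 1, which gives all three limit statements. To
prove it, write E = ∫₀^∞ w(t) dt with w(t) = ∫ (p_t − 1) η, where η is the cross-correlation of the
densities, of size O(ℓ⁻²) and supported at scale ℓ. Times below ℓ² contribute O(1), times above 1
decay exponentially, and in between w(t) = 1/(4πt) + O(1) + O(ℓ²/t²), whose main term integrates to
the logarithm.

Since G is defined by a time integral, its properties come from the heat kernel: a Fourier series
for large times and smoothness, a sum of Gaussian images for small times, Fubini in between. The
Poisson equation is the fundamental theorem of calculus in t for the heat flow p_t ∗ φ
(`sum_torusConv_green_pderiv_pderiv`). -/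

/-! ### Fourier series and regularity of the circle heat kernel. -/

lemma summable_abs_pow_mul_exp (k : ℕ) {c : ℝ} (hc : 0 < c) :
    Summable fun n : ℤ => |(n : ℝ)| ^ k * Real.exp (-c * (n : ℝ) ^ 2) := by
  have h := summable_pow_mul_jacobiTheta₂_term_bound 0 (div_pos hc Real.pi_pos) k
  refine h.congr fun n => ?_
  push_cast
  congr 2
  field_simp
  simp

/-- The spatial derivative of the circle heat kernel, as a Fourier series. -/
def circleHeatDeriv (t s : ℝ) : ℝ :=
  ∑' n : ℤ, -(2 * Real.pi * n) * (Real.exp (-(2 * Real.pi * n) ^ 2 * t) *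
    Real.sin (2 * Real.pi * n * s))

/-- The second spatial derivative of the circle heat kernel, as a Fourier series. -/
def circleHeatDeriv₂ (t s : ℝ) : ℝ :=
  ∑' n : ℤ, -(2 * Real.pi * n) ^ 2 * (Real.exp (-(2 * Real.pi * n) ^ 2 * t) *
    Real.cos (2 * Real.pi * n * s))

/-- A summable majorant for the Fourier series of the heat kernel at times at least `ε`. -/
def fourierBound (k : ℕ) (ε : ℝ) (n : ℤ) : ℝ :=
  |2 * Real.pi * n| ^ k * Real.exp (-(2 * Real.pi * n) ^ 2 * ε)

lemma summable_fourierBound (k : ℕ) {ε : ℝ} (hε : 0 < ε) : Summable (fourierBound k ε) := by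
  have h := (summable_abs_pow_mul_exp k (c := (2 * Real.pi) ^ 2 * ε) (by positivity)).mul_left
    ((2 * Real.pi) ^ k)
  refine h.congr fun n => ?_
  rw [fourierBound, abs_mul, abs_of_pos Real.two_pi_pos, mul_pow, ← mul_assoc]
  ring_nf

lemma norm_fourier_term_le {k : ℕ} {ε t c a : ℝ} {n : ℤ} (ht : ε ≤ t) (hc : |c| ≤ 1)
    (ha : |a| = |2 * Real.pi * n| ^ k) :
    ‖a * (Real.exp (-(2 * Real.pi * n) ^ 2 * t) * c)‖ ≤ fourierBound k ε n := by
  rw [Real.norm_eq_abs, abs_mul, abs_mul, Real.abs_exp, ha, fourierBound]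
  gcongr
  calc _ ≤ Real.exp (-(2 * Real.pi * n) ^ 2 * t) * 1 := by gcongr
    _ ≤ _ := by
      rw [mul_one]
      apply Real.exp_le_exp.2
      nlinarith [sq_nonneg (2 * Real.pi * n)]

/-- Poisson summation, in the form of the functional equation of the theta function. -/
lemma circleHeatKernel_eq_fourier {t : ℝ} (ht : 0 < t) (s : ℝ) :
    circleHeatKernel t s =
      ∑' n : ℤ, Real.exp (-(2 * Real.pi * n) ^ 2 * t) * Real.cos (2 * Real.pi * n * s) := by
  have ha : 0 < (((4 * Real.pi * t : ℝ)) : ℂ).re := by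
    rw [Complex.ofReal_re]; positivity
  -- The shift `I * s` enters the image side multiplied by `I`, producing the real translate n − s;
  -- on the Fourier side it gives the phase 2πns.
  have h := Complex.tsum_exp_neg_quadratic ha (Complex.I * s)
  have hr : (1 / (((4 * Real.pi * t : ℝ)) : ℂ) ^ (1 / 2 : ℂ) * ∑' n : ℤ,
      Complex.exp (-Real.pi / ((4 * Real.pi * t : ℝ) : ℂ) *
        (n + Complex.I * (Complex.I * s)) ^ 2)) = (circleHeatKernel t s : ℂ) := by
    rw [circleHeatKernel, tsum_mul_left, Complex.ofReal_mul (√_)⁻¹, Complex.ofReal_tsum]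
    congr 1
    · rw [Real.sqrt_eq_rpow, Complex.ofReal_inv, Complex.ofReal_cpow (by positivity)]
      simp
    · refine tsum_congr fun n => ?_
      rw [Complex.ofReal_exp]
      congr 1
      have : (Real.pi : ℂ) ≠ 0 := by exact_mod_cast Real.pi_ne_zero
      have h' : (t : ℂ) ≠ 0 := by exact_mod_cast ht.ne'
      push_cast
      rw [← mul_assoc, Complex.I_mul_I]
      field_simp
      ring
  rw [hr] at h
  have hterm (n : ℤ) : Complex.exp (-Real.pi * ((4 * Real.pi * t : ℝ) : ℂ) * n ^ 2 +
      2 * Real.pi * (Complex.I * s) * n) =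
      ((Real.exp (-(2 * Real.pi * n) ^ 2 * t) : ℝ) : ℂ) *
        Complex.exp (((2 * Real.pi * n * s : ℝ) : ℂ) * Complex.I) := by
    rw [Complex.ofReal_exp, ← Complex.exp_add]
    congr 1
    push_cast
    ring
  simp_rw [hterm] at h
  have hsum : Summable fun n : ℤ => ((Real.exp (-(2 * Real.pi * n) ^ 2 * t) : ℝ) : ℂ) *
        Complex.exp (((2 * Real.pi * n * s : ℝ) : ℂ) * Complex.I) := by
    refine Summable.of_norm_bounded (summable_fourierBound 0 ht) fun n => ?_
    rw [norm_mul, Complex.norm_exp_ofReal_mul_I, fourierBound]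
    rw [Complex.norm_real, Real.norm_eq_abs, Real.abs_exp]
    simp
  have h2 := congrArg Complex.re h
  rw [Complex.re_tsum hsum, Complex.ofReal_re] at h2
  rw [← h2]
  refine tsum_congr fun n => ?_
  rw [Complex.re_ofReal_mul, Complex.exp_ofReal_mul_I_re]

lemma hasDerivAt_circleHeatKernel {t : ℝ} (ht : 0 < t) (s : ℝ) :
    HasDerivAt (circleHeatKernel t) (circleHeatDeriv t s) s := by
  have h : circleHeatKernel t = fun s => ∑' n : ℤ, Real.exp (-(2 * Real.pi * n) ^ 2 * t) *
      Real.cos (2 * Real.pi * n * s) := funext (circleHeatKernel_eq_fourier ht)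
  rw [h, circleHeatDeriv]
  refine hasDerivAt_tsum 
    (g := fun (n : ℤ) (s : ℝ) => Real.exp (-(2 * Real.pi * n) ^ 2 * t) *
      Real.cos (2 * Real.pi * n * s))
    (g' := fun (n : ℤ) (s : ℝ) => -(2 * Real.pi * n) *
      (Real.exp (-(2 * Real.pi * n) ^ 2 * t) * Real.sin (2 * Real.pi * n * s)))
    (y₀ := (0 : ℝ)) (summable_fourierBound 1 ht) (fun n y => ?_) (fun n y => ?_) ?_ s
  · refine (((hasDerivAt_id y).const_mul (2 * Real.pi * n)).cos.const_mul
      (Real.exp (-(2 * Real.pi * n) ^ 2 * t))).congr_deriv ?_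
    simp
    ring
  · exact norm_fourier_term_le le_rfl (Real.abs_sin_le_one _) (by simp)
  · refine Summable.of_norm_bounded (summable_fourierBound 0 ht) fun n => ?_
    rw [← one_mul (_ * _)]
    exact norm_fourier_term_le le_rfl (Real.abs_cos_le_one _) (by simp)

lemma hasDerivAt_circleHeatDeriv {t : ℝ} (ht : 0 < t) (s : ℝ) :
    HasDerivAt (circleHeatDeriv t) (circleHeatDeriv₂ t s) s := by
  refine hasDerivAt_tsum 
    (g := fun (n : ℤ) (s : ℝ) => -(2 * Real.pi * n) *
      (Real.exp (-(2 * Real.pi * n) ^ 2 * t) * Real.sin (2 * Real.pi * n * s)))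
    (g' := fun (n : ℤ) (s : ℝ) => -(2 * Real.pi * n) ^ 2 *
      (Real.exp (-(2 * Real.pi * n) ^ 2 * t) * Real.cos (2 * Real.pi * n * s)))
    (y₀ := (0 : ℝ)) (summable_fourierBound 2 ht) (fun n y => ?_) (fun n y => ?_) ?_ s
  · refine ((((hasDerivAt_id y).const_mul (2 * Real.pi * n)).sin.const_mul
      (Real.exp (-(2 * Real.pi * n) ^ 2 * t))).const_mul (-(2 * Real.pi * n))).congr_deriv ?_
    simp
    ring
  · exact norm_fourier_term_le le_rfl (Real.abs_cos_le_one _) (by simp)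
  · refine Summable.of_norm_bounded (summable_fourierBound 1 ht) fun n => ?_
    exact norm_fourier_term_le le_rfl (Real.abs_sin_le_one _) (by simp)

/-- The heat equation: each Fourier mode has the same time derivative as second space derivative.
Termwise differentiation takes place on times above t/2, where one majorant serves all. -/
lemma hasDerivAt_circleHeatKernel_time {t : ℝ} (ht : 0 < t) (s : ℝ) :
    HasDerivAt (fun t => circleHeatKernel t s) (circleHeatDeriv₂ t s) t := by
  have h : (fun t => circleHeatKernel t s) =ᶠ[𝓝 t] fun t => ∑' n : ℤ,
      Real.exp (-(2 * Real.pi * n) ^ 2 * t) * Real.cos (2 * Real.pi * n * s) := by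
    filter_upwards [lt_mem_nhds ht] with r hr using circleHeatKernel_eq_fourier hr s
  refine HasDerivAt.congr_of_eventuallyEq ?_ h
  refine hasDerivAt_tsum_of_isPreconnected 
    (g := fun (n : ℤ) (t : ℝ) => Real.exp (-(2 * Real.pi * n) ^ 2 * t) *
      Real.cos (2 * Real.pi * n * s))
    (g' := fun (n : ℤ) (t : ℝ) => -(2 * Real.pi * n) ^ 2 *
      (Real.exp (-(2 * Real.pi * n) ^ 2 * t) * Real.cos (2 * Real.pi * n * s)))
    (summable_fourierBound 2 (half_pos ht))
    (t := Set.Ioi (t / 2)) isOpen_Ioi isPreconnected_Ioi (y₀ := t) (fun n y _ => ?_)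
    (fun n y hy => ?_) (half_lt_self ht) ?_ (half_lt_self ht)
  · refine (((hasDerivAt_id y).const_mul (-(2 * Real.pi * n) ^ 2)).exp.mul_const
      (Real.cos (2 * Real.pi * n * s))).congr_deriv ?_
    simp
    ring
  · exact norm_fourier_term_le (Set.mem_Ioi.1 hy).le (Real.abs_cos_le_one _) (by simp)
  · refine Summable.of_norm_bounded (summable_fourierBound 0 ht) fun n => ?_
    rw [← one_mul (_ * _)]
    exact norm_fourier_term_le le_rfl (Real.abs_cos_le_one _) (by simp)

/-- The Fourier majorants are uniform only on times at least ε; continuity being local, this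
suffices. -/
lemma continuousOn_of_forall_Ioi {f : ℝ × ℝ → ℝ}
    (h : ∀ ε > 0, ContinuousOn f (Set.Ioi ε ×ˢ Set.univ)) :
    ContinuousOn f (Set.Ioi 0 ×ˢ Set.univ) := by
  rintro ⟨t, s⟩ ⟨ht, -⟩
  have ht' : (0 : ℝ) < t := ht
  refine ((h (t / 2) (half_pos ht')).continuousAt ?_).continuousWithinAt
  exact (isOpen_Ioi.prod isOpen_univ).mem_nhds ⟨half_lt_self ht', trivial⟩

lemma continuousOn_circleHeatKernel :
    ContinuousOn (fun p : ℝ × ℝ => circleHeatKernel p.1 p.2) (Set.Ioi 0 ×ˢ Set.univ) := by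
  refine continuousOn_of_forall_Ioi fun ε hε => ?_
  refine ContinuousOn.congr (f := fun p : ℝ × ℝ => ∑' n : ℤ,
    1 * (Real.exp (-(2 * Real.pi * n) ^ 2 * p.1) * Real.cos (2 * Real.pi * n * p.2)))
    (continuousOn_tsum (fun n => by fun_prop) (summable_fourierBound 0 hε)
      fun n p hp => norm_fourier_term_le (Set.mem_Ioi.1 hp.1).le (Real.abs_cos_le_one _) (by simp))
    fun p hp => ?_
  rw [circleHeatKernel_eq_fourier (hε.trans hp.1)]
  simp

lemma continuousOn_circleHeatDeriv :
    ContinuousOn (fun p : ℝ × ℝ => circleHeatDeriv p.1 p.2) (Set.Ioi 0 ×ˢ Set.univ) :=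
  continuousOn_of_forall_Ioi fun _ hε =>
    continuousOn_tsum (fun n => by fun_prop) (summable_fourierBound 1 hε)
      fun _ _ hp => norm_fourier_term_le (Set.mem_Ioi.1 hp.1).le (Real.abs_sin_le_one _) (by simp)

lemma continuousOn_circleHeatDeriv₂ :
    ContinuousOn (fun p : ℝ × ℝ => circleHeatDeriv₂ p.1 p.2) (Set.Ioi 0 ×ˢ Set.univ) :=
  continuousOn_of_forall_Ioi fun _ hε =>
    continuousOn_tsum (fun n => by fun_prop) (summable_fourierBound 2 hε)
      fun _ _ hp => norm_fourier_term_le (Set.mem_Ioi.1 hp.1).le (Real.abs_cos_le_one _) (by simp)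

lemma circleHeatKernel_add_int (t s : ℝ) (m : ℤ) :
    circleHeatKernel t (s + m) = circleHeatKernel t s := by
  rw [circleHeatKernel, ← (Equiv.addRight m).tsum_eq]
  refine tsum_congr fun n => ?_
  simp only [Equiv.coe_addRight, Int.cast_add]
  ring_nf

lemma circleHeatDeriv_add_int (t s : ℝ) (m : ℤ) :
    circleHeatDeriv t (s + m) = circleHeatDeriv t s := by
  refine tsum_congr fun n => ?_
  have : 2 * Real.pi * n * (s + m) = 2 * Real.pi * n * s + (n * m : ℤ) * (2 * Real.pi) := by
    push_cast; ring
  rw [this, Real.sin_add_int_mul_two_pi]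

lemma circleHeatKernel_neg (t s : ℝ) : circleHeatKernel t (-s) = circleHeatKernel t s := by
  rw [circleHeatKernel, ← (Equiv.neg ℤ).tsum_eq]
  refine tsum_congr fun n => ?_
  simp only [Equiv.neg_apply, Int.cast_neg]
  ring_nf

lemma circleHeatKernel_nonneg (t s : ℝ) : 0 ≤ circleHeatKernel t s :=
  tsum_nonneg fun _ => by positivity

/-! ### Small-time Gaussian bounds on the circle. -/

/-- On the central period 0 is a nearest integer, and |s − n| ≥ |n| − 1/2 ≥ |n|/2 for n ≠ 0. -/
lemma sq_le_sq_sub_int {s : ℝ} (hs : |s| ≤ 1 / 2) (n : ℤ) :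
    s ^ 2 ≤ (s - n) ^ 2 ∧ (n : ℝ) ^ 2 ≤ 4 * (s - n) ^ 2 := by
  obtain ⟨h1, h2⟩ := abs_le.1 hs
  rcases lt_trichotomy n 0 with h | rfl | h
  · have : (n : ℝ) ≤ -1 := by exact_mod_cast Int.le_sub_one_of_lt h
    constructor <;> nlinarith
  · simp; positivity
  · have : (1 : ℝ) ≤ n := by exact_mod_cast h
    constructor <;> nlinarith

/-- Half of the exponent keeps a Gaussian in s; the other half, using t ≤ 1, becomes a factor
summable in n and independent of t. -/
lemma exp_neg_sq_sub_int_le {s t a : ℝ} (hs : |s| ≤ 1 / 2) (ht : t ∈ Set.Ioc (0 : ℝ) 1)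
    (ha : 0 < a) (n : ℤ) :
    Real.exp (-(s - n) ^ 2 / (a * t)) ≤
      Real.exp (-s ^ 2 / (2 * a * t)) * Real.exp (-(1 / (8 * a)) * (n : ℝ) ^ 2) := by
  obtain ⟨h1, h2⟩ := sq_le_sq_sub_int hs n
  have h0 := ht.1
  rw [← Real.exp_add]
  apply Real.exp_le_exp.2
  have e1 : -(s - n) ^ 2 / (a * t) =
    -((s - n) ^ 2 / (2 * a * t)) - (4 * (s - n) ^ 2) / (8 * a * t) := by
    field_simp; ring
  have e2 : -s ^ 2 / (2 * a * t) = -(s ^ 2 / (2 * a * t)) := by ring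
  have e3 : s ^ 2 / (2 * a * t) ≤ (s - n) ^ 2 / (2 * a * t) := by gcongr
  have e4 : (n : ℝ) ^ 2 / (8 * a) ≤ (4 * (s - n) ^ 2) / (8 * a * t) := by
    have : 8 * a * t ≤ 8 * a := by nlinarith [ht.2]
    gcongr
  have e5 : -(1 / (8 * a)) * (n : ℝ) ^ 2 = - ((n : ℝ) ^ 2 / (8 * a)) := by ring
  rw [e1, e2, e5]
  linarith

lemma inv_sqrt_four_pi_mul_le {t : ℝ} (ht : 0 < t) : (√(4 * Real.pi * t))⁻¹ ≤ (√t)⁻¹ := by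
  gcongr
  nlinarith [Real.pi_gt_three]

lemma summable_exp_int {c : ℝ} (hc : 0 < c) :
    Summable fun n : ℤ => Real.exp (-c * (n : ℝ) ^ 2) := by
  simpa using summable_abs_pow_mul_exp 0 hc

lemma summable_circleHeatKernel {t s : ℝ} (hs : |s| ≤ 1 / 2) (ht : t ∈ Set.Ioc (0 : ℝ) 1) :
    Summable fun n : ℤ => (√(4 * Real.pi * t))⁻¹ * Real.exp (-(s - n) ^ 2 / (4 * t)) := by
  refine Summable.mul_left _ (Summable.of_nonneg_of_le (fun _ => by positivity)
    (exp_neg_sq_sub_int_le hs ht four_pos) ((summable_exp_int ?_).mul_left _))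
  positivity

lemma exists_circleHeatKernel_le : ∃ C > 0, ∀ t ∈ Set.Ioc (0 : ℝ) 1, ∀ s : ℝ, |s| ≤ 1 / 2 →
    circleHeatKernel t s ≤ C * (√t)⁻¹ * Real.exp (-s ^ 2 / (8 * t)) := by
  have hsum := summable_exp_int (c := 1 / (8 * 4)) (by positivity)
  refine ⟨∑' n : ℤ, Real.exp (-(1 / (8 * 4)) * (n : ℝ) ^ 2),
    hsum.tsum_pos (fun _ => by positivity) 0 (by positivity), fun t ht s hs => ?_⟩
  have h : circleHeatKernel t s ≤ ∑' n : ℤ, ((√t)⁻¹ * Real.exp (-s ^ 2 / (2 * 4 * t))) *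
      Real.exp (-(1 / (8 * 4)) * (n : ℝ) ^ 2) := by
    refine (summable_circleHeatKernel hs ht).tsum_le_tsum (fun n => ?_) (hsum.mul_left _)
    rw [mul_assoc (√t)⁻¹]
    exact mul_le_mul (inv_sqrt_four_pi_mul_le ht.1) (exp_neg_sq_sub_int_le hs ht four_pos n)
      (by positivity) (by positivity)
  refine h.trans_eq ?_
  rw [tsum_mul_left]
  norm_num
  ring

/-- Only the n = 0 image is singular: the others sit at distance at least 1/2, hence the factor
e^{−1/(32t)}. -/
lemma exists_circleHeatKernel_sub_gauss_le : ∃ C > 0, ∀ t ∈ Set.Ioc (0 : ℝ) 1, ∀ s : ℝ,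
    |s| ≤ 1 / 2 → |circleHeatKernel t s - (√(4 * Real.pi * t))⁻¹ * Real.exp (-s ^ 2 / (4 * t))| ≤
      C * (√t)⁻¹ * Real.exp (-1 / (32 * t)) := by
  have hsum := summable_exp_int (c := 1 / 32) (by positivity)
  refine ⟨∑' n : ℤ, Real.exp (-(1 / 32) * (n : ℝ) ^ 2),
    hsum.tsum_pos (fun _ => by positivity) 0 (by positivity), fun t ht s hs => ?_⟩
  have h0 := ht.1
  have hs' := summable_circleHeatKernel hs ht
  rw [circleHeatKernel, hs'.tsum_eq_add_tsum_ite 0]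
  simp only [Int.cast_zero, sub_zero, add_sub_cancel_left]
  rw [abs_of_nonneg (tsum_nonneg fun n => by split_ifs <;> positivity)]
  have h : ∀ n : ℤ, (if n = 0 then 0 else
      (√(4 * Real.pi * t))⁻¹ * Real.exp (-(s - n) ^ 2 / (4 * t))) ≤
      ((√t)⁻¹ * Real.exp (-1 / (32 * t))) * Real.exp (-(1 / 32) * (n : ℝ) ^ 2) := fun n => by
    split_ifs with hn
    · positivity
    rw [mul_assoc (√t)⁻¹, ← Real.exp_add]
    refine mul_le_mul (inv_sqrt_four_pi_mul_le ht.1) (Real.exp_le_exp.2 ?_)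
      (by positivity) (by positivity)
    have h2 := (sq_le_sq_sub_int hs n).2
    have h1 : (1 : ℝ) ≤ (n : ℝ) ^ 2 := by
      have : 1 ≤ n ^ 2 := by have := Int.one_le_abs hn; nlinarith [sq_abs n]
      exact_mod_cast this
    have e1 : -(s - n) ^ 2 / (4 * t) = -((4 * (s - n) ^ 2) / (32 * t)) -
      (4 * (s - n) ^ 2) / (32 * t) := by field_simp; ring
    have e2 : 1 / (32 * t) ≤ (4 * (s - n) ^ 2) / (32 * t) := by gcongr; linarith
    have e3 : (n : ℝ) ^ 2 / 32 ≤ (4 * (s - n) ^ 2) / (32 * t) := by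
      have : 32 * t ≤ 32 := by linarith [ht.2]
      gcongr
    rw [e1]
    have e4 : -1 / (32 * t) = -(1 / (32 * t)) := by ring
    rw [e4]
    linarith
  have hb := hsum.mul_left ((√t)⁻¹ * Real.exp (-1 / (32 * t)))
  refine (Summable.tsum_le_tsum h (Summable.of_nonneg_of_le (fun n => ?_) h hb) hb).trans_eq ?_
  · split_ifs <;> positivity
  · rw [tsum_mul_left]
    ring

/-- The derivative of the heat kernel of the line. -/
def gaussDeriv (t r : ℝ) : ℝ :=
  -(r / (2 * t)) * ((√(4 * Real.pi * t))⁻¹ * Real.exp (-r ^ 2 / (4 * t)))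

/-- Half of the Gaussian exponent absorbs the factor |r|/√t. -/
lemma abs_gaussDeriv_le {t : ℝ} (ht : 0 < t) (r : ℝ) :
    |gaussDeriv t r| ≤ t⁻¹ * Real.exp (-r ^ 2 / (8 * t)) := by
  have hst : 0 < √t := Real.sqrt_pos.2 ht
  have hsq : √t ^ 2 = t := Real.sq_sqrt ht.le
  rw [gaussDeriv, abs_mul, abs_of_nonneg (a := (√_)⁻¹ * _) (by positivity), abs_neg, abs_div,
    abs_of_pos (by positivity : 0 < 2 * t)]
  have e1 : Real.exp (-r ^ 2 / (4 * t)) =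
      Real.exp (-r ^ 2 / (8 * t)) * Real.exp (-(r ^ 2 / (8 * t))) := by
    rw [← Real.exp_add]; congr 1; field_simp; ring
  -- With y = |r|/√t this is y ≤ 2e^{y²/8}, which follows from e^x ≥ 1 + x and (y − 2)² ≥ 0.
  have e2 : |r| / √t * Real.exp (-(r ^ 2 / (8 * t))) ≤ 2 := by
    rw [Real.exp_neg, ← div_eq_mul_inv, div_le_iff₀ (Real.exp_pos _)]
    have h := Real.add_one_le_exp (r ^ 2 / (8 * t))
    have h' : r ^ 2 / (8 * t) = (|r| / √t) ^ 2 / 8 := by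
      rw [div_pow, hsq, sq_abs]; field_simp
    rw [h'] at h ⊢
    nlinarith [sq_nonneg (|r| / √t - 2)]
  calc _ ≤ |r| / (2 * t) * ((√t)⁻¹ * Real.exp (-r ^ 2 / (4 * t))) := by
        have := inv_sqrt_four_pi_mul_le ht
        gcongr ?_ * (?_ * _)
    _ = (2 * t)⁻¹ * Real.exp (-r ^ 2 / (8 * t)) *
        (|r| / √t * Real.exp (-(r ^ 2 / (8 * t)))) := by rw [e1]; field_simp
    _ ≤ (2 * t)⁻¹ * Real.exp (-r ^ 2 / (8 * t)) * 2 := by gcongr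
    _ = _ := by field_simp

/-- Both sides are the derivative of the same kernel: one from the Fourier series, the other by
differentiating the sum of images termwise. -/
lemma circleHeatDeriv_eq_gauss {t s : ℝ} (hs : |s| ≤ 1 / 2) (ht : t ∈ Set.Ioc (0 : ℝ) 1) :
    circleHeatDeriv t s = ∑' n : ℤ, gaussDeriv t (s - n) := by
  have h0 := ht.1
  refine (hasDerivAt_circleHeatKernel h0 s).unique ?_
  have hbd (n : ℤ) (y : ℝ) (hy : y ∈ Set.Ioo (-1 : ℝ) 1) : ‖gaussDeriv t (y - n)‖ ≤
      t⁻¹ * Real.exp (1 / (8 * t)) * Real.exp (-(1 / (16 * t)) * (n : ℝ) ^ 2) := by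
    refine (abs_gaussDeriv_le h0 _).trans ?_
    rw [mul_assoc, ← Real.exp_add]
    gcongr
    -- From n² ≤ 2(y − n)² + 2y² and |y| < 1.
    have : (n : ℝ) ^ 2 / 2 - 1 ≤ (y - n) ^ 2 := by
      nlinarith [hy.1, hy.2, sq_nonneg (y - n / 2), sq_nonneg (2 * y - n)]
    have e1 : 1 / (8 * t) + -(1 / (16 * t)) * (n : ℝ) ^ 2 = -((n : ℝ) ^ 2 / 2 - 1) / (8 * t) := by
      field_simp; ring
    rw [e1]
    gcongr
  refine hasDerivAt_tsum_of_isPreconnected (𝕜 := ℝ) (F := ℝ)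
    (g := fun (n : ℤ) (s : ℝ) => (√(4 * Real.pi * t))⁻¹ * Real.exp (-(s - n) ^ 2 / (4 * t)))
    (g' := fun (n : ℤ) (s : ℝ) => gaussDeriv t (s - n))
    ((summable_exp_int (c := 1 / (16 * t)) (by positivity)).mul_left _)
    (t := Set.Ioo (-1) 1) isOpen_Ioo isPreconnected_Ioo (y₀ := s) (fun n y _ => ?_)
    hbd ?_ (summable_circleHeatKernel hs ht) ?_
  · refine ((((((hasDerivAt_id y).sub_const (n : ℝ)).pow 2).neg.div_const (4 * t)).exp).const_mul
      (√(4 * Real.pi * t))⁻¹).congr_deriv ?_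
    simp [gaussDeriv]
    ring
  all_goals
    obtain ⟨h1, h2⟩ := abs_le.1 hs
    constructor <;> linarith

lemma exists_abs_circleHeatDeriv_le : ∃ C > 0, ∀ t ∈ Set.Ioc (0 : ℝ) 1, ∀ s : ℝ, |s| ≤ 1 / 2 →
    |circleHeatDeriv t s| ≤ C * t⁻¹ * Real.exp (-s ^ 2 / (16 * t)) := by
  have hsum := summable_exp_int (c := 1 / (8 * 8)) (by positivity)
  refine ⟨∑' n : ℤ, Real.exp (-(1 / (8 * 8)) * (n : ℝ) ^ 2),
    hsum.tsum_pos (fun _ => by positivity) 0 (by positivity), fun t ht s hs => ?_⟩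
  have h0 := ht.1
  rw [circleHeatDeriv_eq_gauss hs ht, ← Real.norm_eq_abs]
  refine (tsum_of_norm_bounded ((hsum.mul_left
    (t⁻¹ * Real.exp (-s ^ 2 / (2 * 8 * t)))).hasSum) fun n => ?_).trans_eq ?_
  · rw [mul_assoc]
    refine (abs_gaussDeriv_le h0 _).trans ?_
    gcongr
    exact exp_neg_sq_sub_int_le hs ht (by norm_num) n
  · rw [tsum_mul_left]
    norm_num
    ring

/-! ### Exponential decay for large times, and the mean of the circle kernel. -/

/-- Spectral gap: (2πn)² ≥ 2 for n ≠ 0, so for t ≥ 1 the exponent (2πn)²t dominates (2πn)²/2 + t. -/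
lemma norm_fourier_term_le_exp {k : ℕ} {t c a : ℝ} {n : ℤ} (hn : n ≠ 0) (ht : 1 ≤ t)
    (hc : |c| ≤ 1) (ha : |a| = |2 * Real.pi * n| ^ k) :
    ‖a * (Real.exp (-(2 * Real.pi * n) ^ 2 * t) * c)‖ ≤
      Real.exp (-t) * fourierBound k (1 / 2) n := by
  refine (norm_fourier_term_le le_rfl hc ha).trans ?_
  rw [fourierBound, fourierBound, mul_left_comm, ← Real.exp_add]
  gcongr
  have h1 : (1 : ℝ) ≤ (n : ℝ) ^ 2 := by
    have : 1 ≤ n ^ 2 := by have := Int.one_le_abs hn; nlinarith [sq_abs n]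
    exact_mod_cast this
  have h2 : 2 ≤ (2 * Real.pi * n) ^ 2 := by
    have : (3 : ℝ) ^ 2 ≤ Real.pi ^ 2 := by gcongr; exact Real.pi_gt_three.le
    nlinarith
  nlinarith

lemma exists_large_time_le : ∃ C > 0, ∀ t : ℝ, 1 ≤ t → ∀ s : ℝ,
    |circleHeatKernel t s - 1| ≤ C * Real.exp (-t) ∧
    |circleHeatDeriv t s| ≤ C * Real.exp (-t) := by
  have hnn (k : ℕ) : 0 ≤ ∑' n : ℤ, fourierBound k (1 / 2) n :=
    tsum_nonneg fun n => by unfold fourierBound; positivity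
  refine ⟨∑' n : ℤ, fourierBound 0 (1 / 2) n + ∑' n : ℤ, fourierBound 1 (1 / 2) n + 1,
    by linarith [hnn 0, hnn 1], fun t ht s => ⟨?_, ?_⟩⟩
  · have h0 : 0 < t := by linarith
    have hsum : Summable fun n : ℤ => Real.exp (-(2 * Real.pi * n) ^ 2 * t) *
        Real.cos (2 * Real.pi * n * s) := by
      refine Summable.of_norm_bounded (summable_fourierBound 0 h0) fun n => ?_
      rw [← one_mul (_ * _)]
      exact norm_fourier_term_le le_rfl (Real.abs_cos_le_one _) (by simp)
    rw [circleHeatKernel_eq_fourier h0, hsum.tsum_eq_add_tsum_ite 0]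
    have e : Real.exp (-(2 * Real.pi * ((0 : ℤ) : ℝ)) ^ 2 * t) *
        Real.cos (2 * Real.pi * ((0 : ℤ) : ℝ) * s) = 1 := by simp
    rw [e, add_sub_cancel_left, ← Real.norm_eq_abs]
    refine (tsum_of_norm_bounded (((summable_fourierBound 0 one_half_pos).mul_left
      (Real.exp (-t))).hasSum) fun n => ?_).trans ?_
    · split_ifs with hn
      · rw [norm_zero]; unfold fourierBound; positivity
      · rw [← one_mul (_ * Real.cos _)]
        exact norm_fourier_term_le_exp hn ht (Real.abs_cos_le_one _) (by simp)
    · rw [tsum_mul_left, mul_comm]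
      gcongr
      linarith [hnn 1]
  · rw [circleHeatDeriv, ← Real.norm_eq_abs]
    refine (tsum_of_norm_bounded (((summable_fourierBound 1 one_half_pos).mul_left
      (Real.exp (-t))).hasSum) fun n => ?_).trans ?_
    · rcases eq_or_ne n 0 with rfl | hn
      · simp [fourierBound]
      · exact norm_fourier_term_le_exp hn ht (Real.abs_sin_le_one _) (by simp)
    · rw [tsum_mul_left, mul_comm]
      gcongr
      linarith [hnn 0]

lemma continuous_circleHeatKernel {t : ℝ} (ht : 0 < t) : Continuous (circleHeatKernel t) :=
  continuous_iff_continuousAt.2 fun s => (hasDerivAt_circleHeatKernel ht s).continuousAt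

lemma continuous_circleHeatDeriv {t : ℝ} (ht : 0 < t) : Continuous (circleHeatDeriv t) :=
  continuous_iff_continuousAt.2 fun s => (hasDerivAt_circleHeatDeriv ht s).continuousAt

lemma integral_cos_two_pi_int {n : ℤ} (hn : n ≠ 0) :
    ∫ s in (-(1 / 2) : ℝ)..(1 / 2), Real.cos (2 * Real.pi * n * s) = 0 := by
  have hn' : (n : ℝ) ≠ 0 := by exact_mod_cast hn
  have h : 2 * Real.pi * n ≠ 0 := by have := Real.pi_ne_zero; positivity
  rw [intervalIntegral.integral_comp_mul_left _ h, integral_cos]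
  have e1 : 2 * Real.pi * n * (1 / 2) = n * Real.pi := by ring
  have e2 : 2 * Real.pi * n * (-(1 / 2)) = -(n * Real.pi) := by ring
  rw [e1, e2, Real.sin_neg, Real.sin_int_mul_pi]
  simp

lemma integral_circleHeatKernel_centered {t : ℝ} (ht : 0 < t) :
    ∫ s in (-(1 / 2) : ℝ)..(1 / 2), circleHeatKernel t s = 1 := by
  have h := intervalIntegral.hasSum_integral_of_dominated_convergence (μ := volume)
    (a := -(1 / 2)) (b := 1 / 2)
    (F := fun (n : ℤ) (s : ℝ) => Real.exp (-(2 * Real.pi * n) ^ 2 * t) *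
      Real.cos (2 * Real.pi * n * s)) (f := circleHeatKernel t)
    (fun n _ => fourierBound 0 t n)
    (fun n => (by fun_prop : Continuous _).aestronglyMeasurable)
    (fun n => Eventually.of_forall fun s _ => by
      rw [← one_mul (_ * _)]
      exact norm_fourier_term_le le_rfl (Real.abs_cos_le_one _) (by simp))
    (Eventually.of_forall fun s _ => summable_fourierBound 0 ht)
    intervalIntegrable_const
    (Eventually.of_forall fun s _ => by
      rw [circleHeatKernel_eq_fourier ht]
      refine (Summable.of_norm_bounded (summable_fourierBound 0 ht) fun n => ?_).hasSum
      rw [← one_mul (_ * _)]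
      exact norm_fourier_term_le le_rfl (Real.abs_cos_le_one _) (by simp))
  refine h.unique ?_
  have h1 := hasSum_ite_eq (0 : ℤ) (1 : ℝ)
  refine h1.congr_fun ?_ 
  intro n
  rw [intervalIntegral.integral_const_mul]
  split_ifs with hn
  · subst hn; norm_num
  · rw [integral_cos_two_pi_int hn, mul_zero]

lemma periodic_circleHeatKernel (t : ℝ) : Function.Periodic (circleHeatKernel t) 1 := fun s => by
  simpa using circleHeatKernel_add_int t s 1

lemma periodic_circleHeatDeriv (t : ℝ) : Function.Periodic (circleHeatDeriv t) 1 := fun s => by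
  simpa using circleHeatDeriv_add_int t s 1

lemma integral_circleHeatKernel {t : ℝ} (ht : 0 < t) (a : ℝ) :
    ∫ s in a..a + 1, circleHeatKernel t s = 1 := by
  rw [(periodic_circleHeatKernel t).intervalIntegral_add_eq a (-(1 / 2))]
  have h := integral_circleHeatKernel_centered ht
  norm_num at h ⊢
  exact h

/-! ### Integration over squares in the plane. -/

/-- The coordinates of the plane, as a measurable equivalence. -/
def planeEquiv : Plane ≃ᵐ ℝ × ℝ :=
  (MeasurableEquiv.toLp 2 (Fin 2 → ℝ)).symm.trans MeasurableEquiv.finTwoArrow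

@[simp] lemma planeEquiv_apply (x : Plane) : planeEquiv x = (x 0, x 1) := rfl

lemma measurePreserving_planeEquiv : MeasurePreserving planeEquiv volume volume :=
  (volume_preserving_finTwoArrow ℝ).comp
    (EuclideanSpace.volume_preserving_symm_measurableEquiv_toLp (Fin 2))

/-- The open square of half-side `R` centred at the origin. -/
def box (R : ℝ) : Set Plane := {x | ∀ i, x i ∈ Set.Ioo (-R) R}

lemma box_eq_preimage (R : ℝ) :
    box R = planeEquiv ⁻¹' (Set.Ioo (-R) R ×ˢ Set.Ioo (-R) R) := by
  ext x
  simp [box, Fin.forall_fin_two, Set.mem_prod]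

lemma isOpen_box (R : ℝ) : IsOpen (box R) := by
  have : box R = ⋂ i, (fun x : Plane => x i) ⁻¹' Set.Ioo (-R) R := by ext x; simp [box]
  rw [this]
  exact isOpen_iInter_of_finite fun i => isOpen_Ioo.preimage (by fun_prop)

lemma measurableSet_box (R : ℝ) : MeasurableSet (box R) := (isOpen_box R).measurableSet

lemma box_mono {R S : ℝ} (h : R ≤ S) : box R ⊆ box S := fun x hx i =>
  ⟨by linarith [(hx i).1], by linarith [(hx i).2]⟩

lemma mem_box_of_norm_lt {R : ℝ} {x : Plane} (hx : ‖x‖ < R) : x ∈ box R := fun i => by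
  have := (PiLp.norm_apply_le x i).trans_lt hx
  rw [Real.norm_eq_abs, abs_lt] at this
  exact this

lemma norm_le_of_mem_box {R : ℝ} {x : Plane} (hx : x ∈ box R) : ‖x‖ ≤ 2 * R := by
  have h0 := hx 0
  have h1 := hx 1
  have hR : 0 ≤ R := by linarith [h0.1, h0.2]
  rw [EuclideanSpace.norm_eq, Fin.sum_univ_two]
  apply Real.sqrt_le_iff.2 ⟨by positivity, ?_⟩
  rw [Real.norm_eq_abs, Real.norm_eq_abs, sq_abs, sq_abs]
  nlinarith [h0.1, h0.2, h1.1, h1.2]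

lemma isBounded_box (R : ℝ) : Bornology.IsBounded (box R) :=
  isBounded_iff_forall_norm_le.2 ⟨2 * R, fun _ => norm_le_of_mem_box⟩

lemma exists_subset_box {s : Set Plane} (hs : Bornology.IsBounded s) : ∃ N : ℕ, s ⊆ box N := by
  obtain ⟨C, hC⟩ := isBounded_iff_forall_norm_le.1 hs
  obtain ⟨N, hN⟩ := exists_nat_gt C
  exact ⟨N, fun x hx => mem_box_of_norm_lt ((hC x hx).trans_lt hN)⟩

lemma volume_box_lt_top (R : ℝ) : volume (box R) < ⊤ := (isBounded_box R).measure_lt_top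

instance (R : ℝ) : IsFiniteMeasure (volume.restrict (box R)) :=
  isFiniteMeasure_restrict.2 (volume_box_lt_top R).ne

lemma integrableOn_box {f : Plane → ℝ} (hf : Continuous f) (R : ℝ) : IntegrableOn f (box R) :=
  (hf.locallyIntegrable.integrableOn_isCompact (isBounded_box R).isCompact_closure).mono_set
    subset_closure

lemma setIntegral_box (f : ℝ × ℝ → ℝ) (R : ℝ) :
    ∫ x in box R, f (x 0, x 1) = ∫ p in Set.Ioo (-R) R ×ˢ Set.Ioo (-R) R, f p := by
  rw [box_eq_preimage]
  exact measurePreserving_planeEquiv.setIntegral_preimage_emb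
    planeEquiv.measurableEmbedding f _

lemma setIntegral_box_mul (f g : ℝ → ℝ) (R : ℝ) (i : Fin 2) :
    ∫ x in box R, f (x i) * g (x i.rev) =
      (∫ s in Set.Ioo (-R) R, f s) * ∫ s in Set.Ioo (-R) R, g s := by
  fin_cases i
  · exact (setIntegral_box (fun p => f p.1 * g p.2) R).trans (setIntegral_prod_mul f g _ _)
  · simp_rw [mul_comm (f _), mul_comm (∫ s in Set.Ioo (-R) R, f s)]
    exact (setIntegral_box (fun p => g p.1 * f p.2) R).trans (setIntegral_prod_mul g f _ _)

lemma ae_coord {p : ℝ → Prop} (h : ∀ᵐ s : ℝ, p s) : ∀ᵐ x : Plane, ∀ i : Fin 2, p (x i) := by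
  rw [ae_all_iff]
  have h0 := (Measure.quasiMeasurePreserving_fst (μ := (volume : Measure ℝ))
    (ν := (volume : Measure ℝ))).comp measurePreserving_planeEquiv.quasiMeasurePreserving
  have h1 := (Measure.quasiMeasurePreserving_snd (μ := (volume : Measure ℝ))
    (ν := (volume : Measure ℝ))).comp measurePreserving_planeEquiv.quasiMeasurePreserving
  intro i
  fin_cases i
  · exact h0.ae h
  · exact h1.ae h

lemma ae_coord_ne_int : ∀ᵐ x : Plane, ∀ (i : Fin 2) (n : ℤ), x i ≠ n :=
  ae_coord (ae_all_iff.2 fun _ => Measure.ae_ne volume _)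

/-- The boundary of the cell is null, so the open, reflection-invariant square replaces it from here
on. -/
lemma setIntegral_cell (f : Plane → ℝ) : ∫ x in cell, f x = ∫ x in box (1 / 2), f x := by
  refine setIntegral_congr_set ?_
  filter_upwards [ae_coord (Measure.ae_ne volume (-(1 / 2) : ℝ))] with x hx
  refine propext (forall_congr' fun i => ?_)
  exact ⟨fun h => ⟨lt_of_le_of_ne h.1 (hx i).symm, h.2⟩, fun h => ⟨h.1.le, h.2⟩⟩

/-! ### Time-integrated kernels and Fubini. -/

lemma continuous_of_continuousOn_uncurry {k : ℝ → Plane → ℝ}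
    (hk : ContinuousOn (Function.uncurry k) (Set.Ioi 0 ×ˢ Set.univ)) {t : ℝ} (ht : 0 < t) :
    Continuous (k t) := by
  rw [← continuousOn_univ]
  exact hk.comp (f := fun x : Plane => (t, x)) (by fun_prop) fun x _ => ⟨ht, trivial⟩

/-- A family of continuous functions on the plane, depending continuously on a positive time,
whose `L¹` norms on bounded sets are integrable in time. -/
structure IsTimeKernel (k : ℝ → Plane → ℝ) : Prop where
  cont : ContinuousOn (Function.uncurry k) (Set.Ioi 0 ×ˢ Set.univ)
  bound : ∀ N : ℕ, ∃ b : ℝ → ℝ, IntegrableOn b (Set.Ioi 0) ∧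
    ∀ t > 0, ∫ x in box N, |k t x| ≤ b t

namespace IsTimeKernel

variable {k : ℝ → Plane → ℝ}

lemma continuous (hk : IsTimeKernel k) {t : ℝ} (ht : 0 < t) : Continuous (k t) :=
  continuous_of_continuousOn_uncurry hk.cont ht

lemma integrable_prod (hk : IsTimeKernel k) (N : ℕ) : Integrable (Function.uncurry k)
    ((volume.restrict (Set.Ioi 0)).prod (volume.restrict (box N))) := by
  have hm : AEStronglyMeasurable (Function.uncurry k)
      ((volume.restrict (Set.Ioi 0)).prod (volume.restrict (box N))) := by
    rw [Measure.prod_restrict]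
    exact (hk.cont.mono (Set.prod_mono le_rfl (Set.subset_univ _))).aestronglyMeasurable
      (measurableSet_Ioi.prod (measurableSet_box N))
  obtain ⟨b, hb, hkb⟩ := hk.bound N
  refine (integrable_prod_iff hm).2 ⟨?_, hb.mono' hm.norm.integral_prod_right' ?_⟩
  · filter_upwards [ae_restrict_mem measurableSet_Ioi] with t ht
    exact integrableOn_box (hk.continuous ht) N
  · filter_upwards [ae_restrict_mem measurableSet_Ioi] with t ht
    rw [Real.norm_of_nonneg (by positivity)]
    exact hkb t ht

lemma locallyIntegrable (hk : IsTimeKernel k) :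
    LocallyIntegrable fun x => ∫ t in Set.Ioi (0 : ℝ), k t x := by
  refine locallyIntegrable_iff.2 fun K hK => ?_
  obtain ⟨N, hN⟩ := exists_subset_box hK.isBounded
  exact IntegrableOn.mono_set (hk.integrable_prod N).integral_prod_right hN

/-- Fubini on (0, ∞) × `box N`. The weight is only bounded and measurable because it will also be
the indicator of a translated cell or a cross-correlation. -/
lemma integral_mul (hk : IsTimeKernel k) {φ : Plane → ℝ} (hm : AEStronglyMeasurable φ)
    {M : ℝ} (hM : ∀ x, |φ x| ≤ M) {N : ℕ} (hN : ∀ x ∉ box N, φ x = 0) :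
    IntegrableOn (fun t => ∫ x, k t x * φ x) (Set.Ioi 0) ∧
    ∫ x, (∫ t in Set.Ioi (0 : ℝ), k t x) * φ x = ∫ t in Set.Ioi (0 : ℝ), ∫ x, k t x * φ x := by
  have hint : Integrable (fun p : ℝ × Plane => k p.1 p.2 * φ p.2)
      ((volume.restrict (Set.Ioi 0)).prod (volume.restrict (box N))) :=
    (hk.integrable_prod N).mul_bdd (c := M) hm.restrict.comp_snd
      (Eventually.of_forall fun p => hM p.2)
  have hbox (f : Plane → ℝ) : ∫ x, f x * φ x = ∫ x in box N, f x * φ x :=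
    (setIntegral_eq_integral_of_forall_compl_eq_zero fun x hx => by rw [hN x hx, mul_zero]).symm
  simp_rw [hbox]
  refine ⟨hint.integral_prod_left, ?_⟩
  refine Eq.trans ?_ (integral_integral_swap (f := fun t x => k t x * φ x) hint).symm
  refine setIntegral_congr_fun (measurableSet_box N) fun x _ => ?_
  exact (integral_mul_const _ _).symm

end IsTimeKernel

/-- Periodicity, by subtracting the nearest integer, removes the restriction |s| ≤ 1/2. -/
lemma exists_circle_bounds : ∃ C > 0, ∀ t ∈ Set.Ioc (0 : ℝ) 1, ∀ s : ℝ,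
    circleHeatKernel t s ≤ C * (√t)⁻¹ ∧ |circleHeatDeriv t s| ≤ C * t⁻¹ := by
  obtain ⟨C, hC, h⟩ := exists_circleHeatKernel_le
  obtain ⟨C', hC', h'⟩ := exists_abs_circleHeatDeriv_le
  refine ⟨C + C', by positivity, fun t ht s => ?_⟩
  have h0 := ht.1
  have hs : |s + (-round s : ℤ)| ≤ 1 / 2 := by
    simpa [← sub_eq_add_neg] using abs_sub_round s
  have hexp (a : ℝ) (ha : 0 < a) : Real.exp (-(s + (-round s : ℤ)) ^ 2 / (a * t)) ≤ 1 := by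
    apply Real.exp_le_one_iff.2
    rw [neg_div]
    exact neg_nonpos.2 (by positivity)
  rw [← circleHeatKernel_add_int t s (-round s), ← circleHeatDeriv_add_int t s (-round s)]
  constructor
  · calc _ ≤ _ := h t ht _ hs
      _ ≤ C * (√t)⁻¹ * 1 := by gcongr; exact hexp 8 (by norm_num)
      _ ≤ (C + C') * (√t)⁻¹ := by rw [mul_one]; gcongr; linarith
  · calc _ ≤ _ := h' t ht _ hs
      _ ≤ C' * t⁻¹ * 1 := by gcongr; exact hexp 16 (by norm_num)
      _ ≤ (C + C') * t⁻¹ := by rw [mul_one]; gcongr; linarith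

/-- Away from the integers the Gaussian beats every power of t. The order t is what is needed to
cancel the singularity t⁻¹ or t^{−1/2} of the factor in the other coordinate. -/
lemma exists_circleHeatKernel_le_of_away {d : ℝ} (hd : 0 < d) : ∃ D > 0,
    ∀ t ∈ Set.Ioc (0 : ℝ) 1, ∀ s : ℝ, (∀ n : ℤ, d ≤ |s - n|) → circleHeatKernel t s ≤ D * t := by
  obtain ⟨C, hC, h⟩ := exists_circleHeatKernel_le
  refine ⟨C * (128 / d ^ 4), by positivity, fun t ht s hs => ?_⟩
  have h0 := ht.1
  have hs' : |s + (-round s : ℤ)| ≤ 1 / 2 := by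
    simpa [← sub_eq_add_neg] using abs_sub_round s
  rw [← circleHeatKernel_add_int t s (-round s)]
  have h1 : d ^ 2 ≤ (s + (-round s : ℤ)) ^ 2 := by
    rw [← sq_abs (s + _)]
    have := hs (round s)
    push_cast
    rw [← sub_eq_add_neg]
    gcongr
  have h2 : (√t)⁻¹ ≤ t⁻¹ := by
    gcongr
    exact Real.le_sqrt_of_sq_le (by nlinarith [ht.2])
  have h3 : Real.exp (-(s + (-round s : ℤ)) ^ 2 / (8 * t)) ≤ 128 * t ^ 2 / d ^ 4 := by
    calc _ ≤ Real.exp (-(d ^ 2 / (8 * t))) := by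
          rw [← neg_div]
          gcongr
      _ ≤ 128 * t ^ 2 / d ^ 4 := by
          -- e^{−x} ≤ 2/x² at x = d²/(8t), hence the constant 128 = 2 · 8².
          have h5 := Real.quadratic_le_exp_of_nonneg (x := d ^ 2 / (8 * t)) (by positivity)
          have h6 : (d ^ 2 / (8 * t)) ^ 2 / 2 ≤ Real.exp (d ^ 2 / (8 * t)) := by
            have : 0 ≤ d ^ 2 / (8 * t) := by positivity
            linarith
          rw [Real.exp_neg]
          have h7 : 128 * t ^ 2 / d ^ 4 = ((d ^ 2 / (8 * t)) ^ 2 / 2)⁻¹ := by field_simp; norm_num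
          rw [h7]
          gcongr
  calc _ ≤ _ := h t ht _ hs'
    _ ≤ C * t⁻¹ * (128 * t ^ 2 / d ^ 4) := by gcongr
    _ = _ := by field_simp

lemma exists_forall_le_abs_sub_int {s : ℝ} (hs : ∀ n : ℤ, s ≠ n) :
    ∃ d > 0, ∀ n : ℤ, d ≤ |s - n| :=
  ⟨|s - round s|, abs_pos.2 (sub_ne_zero.2 (hs _)), fun n => round_le s n⟩

lemma setIntegral_periodic {f : ℝ → ℝ} (hf : Function.Periodic f 1) (hc : Continuous f)
    (N : ℕ) :
    ∫ s in Set.Ioo (-(N : ℝ)) N, f s = 2 * N * ∫ s in (-(1 / 2) : ℝ)..(1 / 2), f s := by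
  have h := hf.intervalIntegral_add_zsmul_eq (2 * N) (-(N : ℝ)) fun _ _ =>
    hc.intervalIntegrable _ _
  have e : -(N : ℝ) + ((2 * N : ℤ)) • (1 : ℝ) = N := by simp; ring
  have h2 := hf.intervalIntegral_add_eq (-(N : ℝ)) (-(1 / 2))
  have e2 : (-(1 / 2) + 1 : ℝ) = 1 / 2 := by norm_num
  rw [e, h2, e2] at h
  rw [← integral_Ioc_eq_integral_Ioo, ← intervalIntegral.integral_of_le (by simp), h]
  simp

lemma setIntegral_circleHeatKernel {t : ℝ} (ht : 0 < t) (N : ℕ) :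
    ∫ s in Set.Ioo (-(N : ℝ)) N, circleHeatKernel t s = 2 * N := by
  rw [setIntegral_periodic (periodic_circleHeatKernel t) (continuous_circleHeatKernel ht),
    integral_circleHeatKernel_centered ht,
    mul_one]

/-- The pointwise bound t⁻¹ is not integrable at t = 0; integrating its Gaussian factor in space
gains √t and leaves the integrable t^{−1/2}. -/
lemma exists_integral_abs_circleHeatDeriv_le : ∃ C > 0, ∀ t ∈ Set.Ioc (0 : ℝ) 1,
    ∫ s in (-(1 / 2) : ℝ)..(1 / 2), |circleHeatDeriv t s| ≤ C * (√t)⁻¹ := by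
  obtain ⟨C, hC, h⟩ := exists_abs_circleHeatDeriv_le
  refine ⟨C * √(Real.pi * 16), by positivity, fun t ht => ?_⟩
  have h0 := ht.1
  have hg : Integrable fun s : ℝ => C * t⁻¹ * Real.exp (-(1 / (16 * t)) * s ^ 2) :=
    (integrable_exp_neg_mul_sq (by positivity)).const_mul _
  rw [intervalIntegral.integral_of_le (by norm_num)]
  calc _ ≤ ∫ s in Set.Ioc (-(1 / 2) : ℝ) (1 / 2), C * t⁻¹ * Real.exp (-(1 / (16 * t)) * s ^ 2) := by
        refine setIntegral_mono_on ?_ hg.integrableOn measurableSet_Ioc fun s hs => ?_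
        · exact ((continuous_circleHeatDeriv h0).abs.integrableOn_Icc).mono_set
            Set.Ioc_subset_Icc_self
        · have := h t ht s (abs_le.2 ⟨hs.1.le, hs.2⟩)
          rwa [neg_div, div_eq_mul_one_div, mul_comm (s ^ 2), ← neg_mul] at this
    _ ≤ ∫ s, C * t⁻¹ * Real.exp (-(1 / (16 * t)) * s ^ 2) :=
        setIntegral_le_integral hg (Eventually.of_forall fun s => by positivity)
    _ = C * t⁻¹ * √(Real.pi / (1 / (16 * t))) := by
        rw [integral_const_mul, integral_gaussian]
    _ = C * t⁻¹ * (√(Real.pi * 16) * √t) := by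
        rw [← Real.sqrt_mul (by positivity)]
        congr 2
        field_simp
    _ = _ := by
        have : t⁻¹ * √t = (√t)⁻¹ := by
          rw [← Real.sq_sqrt h0.le]
          have : √t ≠ 0 := (Real.sqrt_pos.2 h0).ne'
          rw [Real.sqrt_sq (by positivity)]
          field_simp
        rw [← this]
        ring

/-! ### The heat kernel of the torus as a time kernel. -/

lemma heatKernel_eq (t : ℝ) (x : Plane) (i : Fin 2) :
    heatKernel t x = circleHeatKernel t (x i) * circleHeatKernel t (x i.rev) := by
  rw [heatKernel, Fin.prod_univ_two]
  fin_cases i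
  · rfl
  · exact mul_comm _ _

lemma heatKernel_nonneg (t : ℝ) (x : Plane) : 0 ≤ heatKernel t x :=
  Finset.prod_nonneg fun _ _ => circleHeatKernel_nonneg _ _

/-- The partial derivatives of the heat kernel of the torus. -/
def heatGrad (i : Fin 2) (t : ℝ) (x : Plane) : ℝ :=
  circleHeatDeriv t (x i) * circleHeatKernel t (x i.rev)

/-- The pure second partial derivatives of the heat kernel of the torus. -/
def heatHess (i : Fin 2) (t : ℝ) (x : Plane) : ℝ :=
  circleHeatDeriv₂ t (x i) * circleHeatKernel t (x i.rev)

lemma continuousOn_comp_coord {f : ℝ × ℝ → ℝ} (hf : ContinuousOn f (Set.Ioi 0 ×ˢ Set.univ))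
    (i : Fin 2) : ContinuousOn (fun p : ℝ × Plane => f (p.1, p.2 i)) (Set.Ioi 0 ×ˢ Set.univ) :=
  hf.comp (f := fun p : ℝ × Plane => (p.1, p.2 i)) (by fun_prop) fun _ hp => ⟨hp.1, trivial⟩

lemma continuousOn_heatKernel :
    ContinuousOn (Function.uncurry heatKernel) (Set.Ioi 0 ×ˢ Set.univ) := by
  refine ((continuousOn_comp_coord continuousOn_circleHeatKernel 0).mul
    (continuousOn_comp_coord continuousOn_circleHeatKernel 1)).congr fun p _ => ?_
  exact heatKernel_eq p.1 p.2 0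

lemma continuousOn_heatGrad (i : Fin 2) :
    ContinuousOn (Function.uncurry (heatGrad i)) (Set.Ioi 0 ×ˢ Set.univ) :=
  (continuousOn_comp_coord continuousOn_circleHeatDeriv i).mul
    (continuousOn_comp_coord continuousOn_circleHeatKernel i.rev)

lemma continuousOn_heatHess (i : Fin 2) :
    ContinuousOn (Function.uncurry (heatHess i)) (Set.Ioi 0 ×ˢ Set.univ) :=
  (continuousOn_comp_coord continuousOn_circleHeatDeriv₂ i).mul
    (continuousOn_comp_coord continuousOn_circleHeatKernel i.rev)

lemma continuous_heatKernel {t : ℝ} (ht : 0 < t) : Continuous (heatKernel t) :=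
  continuous_of_continuousOn_uncurry continuousOn_heatKernel ht

lemma setIntegral_heatKernel {t : ℝ} (ht : 0 < t) (N : ℕ) :
    ∫ x in box N, heatKernel t x = (2 * N) ^ 2 := by
  simp_rw [heatKernel_eq t _ 0]
  rw [setIntegral_box_mul, setIntegral_circleHeatKernel ht, sq]

lemma exists_large_time_plane_le : ∃ C > 0, ∀ t : ℝ, 1 ≤ t → ∀ x : Plane,
    |heatKernel t x - 1| ≤ C * Real.exp (-t) ∧ ∀ i, |heatGrad i t x| ≤ C * Real.exp (-t) := by
  obtain ⟨C, hC, h⟩ := exists_large_time_le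
  have hbd (t : ℝ) (ht : 1 ≤ t) (s : ℝ) : |circleHeatKernel t s| ≤ 1 + C := by
    have h1 : C * Real.exp (-t) ≤ C * 1 := by
      gcongr; exact Real.exp_le_one_iff.2 (by linarith)
    have h2 := (h t ht s).1
    have h3 := abs_sub_abs_le_abs_sub (circleHeatKernel t s) 1
    rw [abs_one] at h3
    linarith
  refine ⟨C * (1 + C) + C, by positivity, fun t ht x => ⟨?_, fun i => ?_⟩⟩
  · rw [heatKernel_eq t x 0]
    have e : circleHeatKernel t (x 0) * circleHeatKernel t (x (Fin.rev 0)) - 1 =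
      (circleHeatKernel t (x 0) - 1) * circleHeatKernel t (x (Fin.rev 0)) +
        (circleHeatKernel t (x (Fin.rev 0)) - 1) := by ring
    rw [e]
    refine (abs_add_le _ _).trans ?_
    rw [abs_mul]
    calc _ ≤ (C * Real.exp (-t)) * (1 + C) + C * Real.exp (-t) := by
          gcongr
          · exact (h t ht _).1
          · exact hbd t ht _
          · exact (h t ht _).1
      _ = _ := by ring
  · rw [heatGrad, abs_mul]
    calc _ ≤ (C * Real.exp (-t)) * (1 + C) := by
          gcongr
          · exact (h t ht _).2
          · exact hbd t ht _
      _ ≤ _ := by nlinarith [Real.exp_pos (-t)]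

lemma setIntegral_box_le_const {f : Plane → ℝ} {C : ℝ} (hf : ∀ x, |f x| ≤ C) (R : ℝ) :
    ∫ x in box R, |f x| ≤ C * volume.real (box R) := by
  have := norm_setIntegral_le_of_norm_le_const (f := fun x => |f x|) (volume_box_lt_top R)
    (C := C) fun x _ => by simpa using hf x
  exact (le_abs_self _).trans this

/-- For t ≥ 1 the deviation from 1 decays exponentially; for t ≤ 1 positivity gives |p − 1| ≤ p + 1,
whose integral over the box is explicit. -/
lemma isTimeKernel_heatKernel_sub_one : IsTimeKernel fun t x => heatKernel t x - 1 where
  cont := continuousOn_heatKernel.sub continuousOn_const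
  bound N := by
    obtain ⟨C, hC, h⟩ := exists_large_time_plane_le
    set V := volume.real (box N)
    have hV : 0 ≤ V := measureReal_nonneg
    -- Since e · e^{−t} ≥ 1 for t ≤ 1, a single multiple of e^{−t} dominates both regimes.
    refine ⟨fun t => (C * V + ((2 * N) ^ 2 + V) * Real.exp 1) * Real.exp (-t),
      (integrableOn_exp_neg_Ioi 0).const_mul _, fun t ht => ?_⟩
    rcases le_total 1 t with h1 | h1
    · refine (setIntegral_box_le_const (fun x => (h t h1 x).1) N).trans ?_
      have : 0 ≤ ((2 * N) ^ 2 + V) * Real.exp 1 * Real.exp (-t) := by positivity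
      change C * Real.exp (-t) * V ≤ _
      nlinarith
    · have hi := integrableOn_box (continuous_heatKernel ht) N
      have h2 : ∫ x in box N, |heatKernel t x - 1| ≤ ∫ x in box N, (heatKernel t x + 1) := by
        refine integral_mono_ae (integrableOn_box ((continuous_heatKernel ht).sub
          continuous_const).abs N) (hi.add (integrable_const 1)) (Eventually.of_forall fun x => ?_)
        have := heatKernel_nonneg t x
        exact abs_le.2 ⟨by simp; linarith, by simp; linarith⟩
      rw [integral_add hi (integrable_const 1), setIntegral_heatKernel ht] at h2
      simp only [integral_const, measureReal_restrict_apply_univ, smul_eq_mul, mul_one] at h2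
      refine h2.trans ?_
      change (2 * (N : ℝ)) ^ 2 + V ≤ _
      have h3 : 1 ≤ Real.exp 1 * Real.exp (-t) := by
        rw [← Real.exp_add]; exact Real.one_le_exp (by linarith)
      have h4 : 0 ≤ C * V * Real.exp (-t) := by positivity
      have h5 : 0 ≤ (2 * (N : ℝ)) ^ 2 + V := by positivity
      nlinarith

/-- For small times the product structure reduces the L¹ norm to that of the circle derivative,
O(t^{−1/2}); the majorant e^{−t} t^{−1/2} is the integrand of Γ(1/2). -/
lemma isTimeKernel_heatGrad (i : Fin 2) : IsTimeKernel (heatGrad i) where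
  cont := continuousOn_heatGrad i
  bound N := by
    obtain ⟨C, hC, h⟩ := exists_large_time_plane_le
    obtain ⟨D, hD, h'⟩ := exists_integral_abs_circleHeatDeriv_le
    set V := volume.real (box N)
    have hV : 0 ≤ V := measureReal_nonneg
    have hint : IntegrableOn (fun t : ℝ => Real.exp (-t) * (√t)⁻¹) (Set.Ioi 0) := by
      refine (Real.GammaIntegral_convergent (s := 1 / 2) (by norm_num)).congr_fun (fun t ht => ?_)
        measurableSet_Ioi
      have h0 : (0 : ℝ) < t := ht
      simp only
      rw [Real.sqrt_eq_rpow, ← Real.rpow_neg h0.le]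
      norm_num
    refine ⟨fun t => C * V * Real.exp (-t) + (2 * N) ^ 2 * D * Real.exp 1 *
      (Real.exp (-t) * (√t)⁻¹), Integrable.fun_add ((integrableOn_exp_neg_Ioi 0).const_mul (C * V))
        (hint.const_mul ((2 * N) ^ 2 * D * Real.exp 1)), fun t ht => ?_⟩
    rcases le_total 1 t with h1 | h1
    · refine (setIntegral_box_le_const (fun x => (h t h1 x).2 i) N).trans ?_
      have : 0 ≤ (2 * N) ^ 2 * D * Real.exp 1 * (Real.exp (-t) * (√t)⁻¹) := by positivity
      change C * Real.exp (-t) * V ≤ _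
      nlinarith
    · have hp : Function.Periodic (fun s => |circleHeatDeriv t s|) 1 := fun s =>
        congrArg abs (periodic_circleHeatDeriv t s)
      simp_rw [heatGrad, abs_mul, abs_of_nonneg (circleHeatKernel_nonneg t _)]
      rw [setIntegral_box_mul (fun s => |circleHeatDeriv t s|), setIntegral_periodic hp
        (continuous_circleHeatDeriv ht).abs,
        setIntegral_circleHeatKernel ht]
      have h3 : 1 ≤ Real.exp 1 * Real.exp (-t) := by
        rw [← Real.exp_add]; exact Real.one_le_exp (by linarith)
      calc _ ≤ 2 * N * (D * (√t)⁻¹) * (2 * N) := by gcongr; exact h' t ⟨ht, h1⟩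
        _ = (2 * N) ^ 2 * D * (√t)⁻¹ * 1 := by ring
        _ ≤ (2 * N) ^ 2 * D * (√t)⁻¹ * (Real.exp 1 * Real.exp (-t)) := by gcongr
        _ = (2 * N) ^ 2 * D * Real.exp 1 * (Real.exp (-t) * (√t)⁻¹) := by ring
        _ ≤ _ := le_add_of_nonneg_left (by positivity)

/-! ### Test functions and the gradient of the Green function. -/

/-- The unit vectors of the plane. -/
def unitVec (i : Fin 2) : Plane := EuclideanSpace.single i 1

@[simp] lemma add_smul_unitVec_self (x : Plane) (r : ℝ) (i : Fin 2) :
    (x + r • unitVec i) i = x i + r := by simp [unitVec]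

@[simp] lemma add_smul_unitVec_rev (x : Plane) (r : ℝ) (i : Fin 2) :
    (x + r • unitVec i) i.rev = x i.rev := by
  have : i.rev ≠ i := by fin_cases i <;> decide
  simp [unitVec, this]

lemma pderiv_eq_fderiv {f : Plane → ℝ} {x : Plane} (hf : DifferentiableAt ℝ f x) (i : Fin 2) :
    pderiv i f x = fderiv ℝ f x (unitVec i) :=
  hf.lineDeriv_eq_fderiv

/-- Smooth functions on the plane supported in the open fundamental cell. -/
structure IsTest (φ : Plane → ℝ) : Prop where
  smooth : ContDiff ℝ ∞ φ
  compact : HasCompactSupport φ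
  support : tsupport φ ⊆ box (1 / 2)

namespace IsTest

variable {φ : Plane → ℝ}

lemma eq_zero (hφ : IsTest φ) {x : Plane} (hx : x ∉ box (1 / 2)) : φ x = 0 :=
  image_eq_zero_of_notMem_tsupport fun h => hx (hφ.support h)

lemma differentiable (hφ : IsTest φ) : Differentiable ℝ φ := hφ.smooth.differentiable (by simp)

lemma continuous (hφ : IsTest φ) : Continuous φ := hφ.smooth.continuous

lemma integrable (hφ : IsTest φ) : Integrable φ :=
  hφ.continuous.integrable_of_hasCompactSupport hφ.compact

lemma pderiv_eq (hφ : IsTest φ) (i : Fin 2) :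
    pderiv i φ = fun x => fderiv ℝ φ x (unitVec i) :=
  funext fun x => pderiv_eq_fderiv (hφ.differentiable x) i

lemma pderiv (hφ : IsTest φ) (i : Fin 2) : IsTest (pderiv i φ) := by
  rw [hφ.pderiv_eq]
  refine ⟨(hφ.smooth.fderiv_right (m := ∞) (by simp)).clm_apply contDiff_const,
    hφ.compact.fderiv_apply ℝ _, (tsupport_fderiv_apply_subset ℝ _).trans hφ.support⟩

lemma exists_bound (hφ : IsTest φ) : ∃ M > 0, ∀ x, |φ x| ≤ M := by
  obtain ⟨M, hM⟩ := hφ.compact.exists_bound_of_continuous hφ.continuous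
  exact ⟨max M 1, by positivity, fun x => (hM x).trans (le_max_left _ _)⟩

lemma hasCompactSupport_sub (hφ : IsTest φ) (x : Plane) :
    HasCompactSupport fun z => φ (x - z) :=
  hφ.compact.comp_homeomorph (Homeomorph.subLeft x)

lemma hasLineDerivAt_sub (hφ : IsTest φ) (i : Fin 2) (x z : Plane) :
    HasLineDerivAt ℝ (fun z => φ (x - z)) (-VortexNoise.pderiv i φ (x - z)) z (unitVec i) := by
  rw [hφ.pderiv_eq]
  have h := (hφ.differentiable (x - z)).hasFDerivAt.comp z ((hasFDerivAt_id z).const_sub x)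
  convert! h.hasLineDerivAt (unitVec i) using 1
  simp

lemma exists_sub_eq_zero (hφ : IsTest φ) (x : Plane) :
    ∃ N : ℕ, ∀ z ∉ box N, φ (x - z) = 0 := by
  obtain ⟨N, hN⟩ := exists_subset_box (hφ.hasCompactSupport_sub x).isCompact.isBounded
  exact ⟨N, fun z hz => image_eq_zero_of_notMem_tsupport (f := fun z => φ (x - z))
    fun h => hz (hN h)⟩

lemma integrable_mul_sub (hφ : IsTest φ) {f : Plane → ℝ} (hf : LocallyIntegrable f) (x : Plane) :
    Integrable fun z => f z * φ (x - z) :=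
  hf.integrable_smul_right_of_hasCompactSupport (hφ.continuous.comp (by fun_prop))
    (hφ.hasCompactSupport_sub x)

end IsTest

lemma torusConv_eq {f φ : Plane → ℝ} (hφ : ∀ x ∉ box (1 / 2), φ x = 0) (x : Plane) :
    torusConv f φ x = ∫ y, f (x - y) * φ y := by
  rw [torusConv, setIntegral_cell]
  exact setIntegral_eq_integral_of_forall_compl_eq_zero fun y hy => by rw [hφ y hy, mul_zero]

lemma torusConv_eq_sub {f φ : Plane → ℝ} (hφ : ∀ x ∉ box (1 / 2), φ x = 0) (x : Plane) :
    torusConv f φ x = ∫ z, f z * φ (x - z) := by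
  rw [torusConv_eq hφ, ← integral_sub_left_eq_self _ volume x]
  simp

lemma IsTimeKernel.torusConv_eq {k : ℝ → Plane → ℝ} (hk : IsTimeKernel k) {φ : Plane → ℝ}
    (hφ : IsTest φ) (x : Plane) :
    IntegrableOn (fun t => ∫ z, k t z * φ (x - z)) (Set.Ioi 0) ∧
    torusConv (fun z => ∫ t in Set.Ioi (0 : ℝ), k t z) φ x =
      ∫ t in Set.Ioi (0 : ℝ), ∫ z, k t z * φ (x - z) := by
  obtain ⟨M, -, hM⟩ := hφ.exists_bound
  obtain ⟨N, hN⟩ := hφ.exists_sub_eq_zero x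
  rw [torusConv_eq_sub fun _ => hφ.eq_zero]
  exact hk.integral_mul (φ := fun z => φ (x - z))
    (hφ.continuous.comp (by fun_prop)).aestronglyMeasurable (fun z => hM _) hN

/-- Integration by parts; its sign cancels the one from differentiating z ↦ φ(x − z). -/
lemma integral_deriv_mul_sub {f f' φ : Plane → ℝ} {i : Fin 2} (hf : Continuous f)
    (hf' : Continuous f') (hd : ∀ x, HasLineDerivAt ℝ f (f' x) x (unitVec i)) (hφ : IsTest φ)
    (x : Plane) :
    ∫ z, f' z * φ (x - z) = ∫ z, f z * pderiv i φ (x - z) := by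
  have h := integral_bilinear_hasLineDerivAt_right_eq_neg_left_of_integrable (μ := volume)
    (f := f) (f' := f') (g := fun z => φ (x - z)) (g' := fun z => -pderiv i φ (x - z))
    (v := unitVec i) (B := ContinuousLinearMap.mul ℝ ℝ)
    (hφ.integrable_mul_sub hf'.locallyIntegrable x)
    (by simpa using ((hφ.pderiv i).integrable_mul_sub hf.locallyIntegrable x).neg)
    (hφ.integrable_mul_sub hf.locallyIntegrable x)
    (fun z _ => hd z) (fun z _ => hφ.hasLineDerivAt_sub i x z)
  simp only [ContinuousLinearMap.mul_apply', mul_neg, integral_neg, neg_inj] at h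
  exact h.symm

lemma hasLineDerivAt_heatKernel {t : ℝ} (ht : 0 < t) (i : Fin 2) (x : Plane) :
    HasLineDerivAt ℝ (heatKernel t) (heatGrad i t x) x (unitVec i) := by
  unfold HasLineDerivAt heatGrad
  simp_rw [heatKernel_eq t _ i, add_smul_unitVec_self, add_smul_unitVec_rev]
  refine HasDerivAt.mul_const ?_ _
  exact HasDerivAt.comp_const_add (x i) 0 (by simpa using hasDerivAt_circleHeatKernel ht (x i))

lemma hasLineDerivAt_heatGrad {t : ℝ} (ht : 0 < t) (i : Fin 2) (x : Plane) :
    HasLineDerivAt ℝ (heatGrad i t) (heatHess i t x) x (unitVec i) := by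
  unfold HasLineDerivAt heatHess heatGrad
  simp_rw [add_smul_unitVec_self, add_smul_unitVec_rev]
  refine HasDerivAt.mul_const ?_ _
  exact HasDerivAt.comp_const_add (x i) 0 (by simpa using hasDerivAt_circleHeatDeriv ht (x i))

lemma hasDerivAt_heatKernel_time {t : ℝ} (ht : 0 < t) (x : Plane) :
    HasDerivAt (fun t => heatKernel t x) (∑ i, heatHess i t x) t := by
  simp_rw [heatKernel_eq _ x 0]
  refine ((hasDerivAt_circleHeatKernel_time ht (x 0)).mul
    (hasDerivAt_circleHeatKernel_time ht (x 1))).congr_deriv ?_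
  rw [Fin.sum_univ_two, heatHess, heatHess]
  exact congrArg₂ _ rfl (mul_comm _ _)

/-- Differentiation under the time integral. Along direction i the other coordinate is fixed at a
distance d > 0 from the integers, so its factor is O(t) and cancels the O(t⁻¹) of the differentiated
factor, uniformly along the whole line. -/
lemma hasLineDerivAt_green {x : Plane} (hx : ∀ (i : Fin 2) (n : ℤ), x i ≠ n) (i : Fin 2) :
    HasLineDerivAt ℝ green (∫ t in Set.Ioi (0 : ℝ), heatGrad i t x) x (unitVec i) := by
  obtain ⟨C, hC, hbig⟩ := exists_large_time_plane_le
  obtain ⟨B, hB, hsmall⟩ := exists_circle_bounds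
  obtain ⟨d, hd, hdx⟩ := exists_forall_le_abs_sub_int (hx i.rev)
  obtain ⟨D, hD, haway⟩ := exists_circleHeatKernel_le_of_away hd
  have hm (f : ℝ → Plane → ℝ) (hf : ContinuousOn (Function.uncurry f) (Set.Ioi 0 ×ˢ Set.univ))
      (y : Plane) : AEStronglyMeasurable (fun t => f t y) (volume.restrict (Set.Ioi 0)) :=
    (hf.comp (f := fun t : ℝ => (t, y)) (by fun_prop)
      fun t ht => ⟨ht, trivial⟩).aestronglyMeasurable measurableSet_Ioi
  have hexp {t : ℝ} (h1 : t ≤ 1) : 1 ≤ Real.exp 1 * Real.exp (-t) := by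
    rw [← Real.exp_add]; exact Real.one_le_exp (by linarith)
  have hbound : IntegrableOn (fun t => (C + (B * D + 1) * Real.exp 1) * Real.exp (-t))
      (Set.Ioi 0) := (integrableOn_exp_neg_Ioi 0).const_mul _
  have hfin (K t : ℝ) (h1 : t ≤ 1) (hK : K ≤ B * D + 1) :
      K ≤ (C + (B * D + 1) * Real.exp 1) * Real.exp (-t) := by
    have h2 := hexp h1
    have h3 : 0 ≤ C * Real.exp (-t) := by positivity
    have h4 : 0 < B * D := by positivity
    nlinarith
  have hfin' (K t : ℝ) (hK : K ≤ C * Real.exp (-t)) :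
      K ≤ (C + (B * D + 1) * Real.exp 1) * Real.exp (-t) := by
    have h3 : 0 ≤ (B * D + 1) * Real.exp 1 * Real.exp (-t) := by positivity
    linarith
  have key := hasDerivAt_integral_of_dominated_loc_of_deriv_le (𝕜 := ℝ)
    (μ := volume.restrict (Set.Ioi 0)) (x₀ := (0 : ℝ)) (s := Set.univ)
    (F := fun r t => heatKernel t (x + r • unitVec i) - 1)
    (F' := fun r t => heatGrad i t (x + r • unitVec i))
    (bound := fun t => (C + (B * D + 1) * Real.exp 1) * Real.exp (-t)) univ_mem
    (Eventually.of_forall fun r => (hm _ continuousOn_heatKernel _).sub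
      aestronglyMeasurable_const) ?_ (hm _ (continuousOn_heatGrad i) _) ?_ hbound ?_
  · have h2 := key.2
    simp only [zero_smul, add_zero] at h2
    exact h2
  · refine hbound.mono' ((hm _ continuousOn_heatKernel _).sub aestronglyMeasurable_const) ?_
    filter_upwards [ae_restrict_mem measurableSet_Ioi] with t ht
    rcases le_total 1 t with h1 | h1
    · exact hfin' _ _ (hbig t h1 _).1
    · refine hfin _ _ h1 (abs_le.2 ?_)
      have h0 : 0 < t := ht
      have h2 := heatKernel_nonneg t (x + (0 : ℝ) • unitVec i)
      have h4 : 0 < B * D := by positivity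
      refine ⟨by linarith, ?_⟩
      have h3 : heatKernel t (x + (0 : ℝ) • unitVec i) ≤ B * t⁻¹ * (D * t) := by
        rw [heatKernel_eq _ _ i, add_smul_unitVec_rev]
        gcongr
        · exact circleHeatKernel_nonneg _ _
        · refine (hsmall t ⟨ht, h1⟩ _).1.trans ?_
          gcongr
          exact Real.le_sqrt_of_sq_le (by nlinarith)
        · exact haway t ⟨ht, h1⟩ _ hdx
      have h5 : B * t⁻¹ * (D * t) = B * D := by field_simp
      linarith
  · filter_upwards [ae_restrict_mem measurableSet_Ioi] with t ht r _
    rcases le_total 1 t with h1 | h1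
    · exact hfin' _ _ ((hbig t h1 _).2 i)
    · refine hfin _ _ h1 ?_
      have h0 : 0 < t := ht
      rw [heatGrad, norm_mul, Real.norm_eq_abs, Real.norm_of_nonneg (circleHeatKernel_nonneg _ _),
        add_smul_unitVec_rev]
      calc _ ≤ B * t⁻¹ * (D * t) := by
            gcongr
            · exact circleHeatKernel_nonneg _ _
            · exact (hsmall t ⟨ht, h1⟩ _).2
            · exact haway t ⟨ht, h1⟩ _ hdx
        _ = B * D := by field_simp
        _ ≤ _ := by linarith
  · filter_upwards [ae_restrict_mem measurableSet_Ioi] with t ht r _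
    have h := (hasLineDerivAt_heatKernel ht i (x + r • unitVec i)).sub_const 1
    have h' := HasDerivAt.scomp_of_eq r (h := fun r' => r' - r) h
      ((hasDerivAt_id r).sub_const r) (by simp)
    refine (h'.congr_deriv (by simp)).congr_of_eventuallyEq (Eventually.of_forall fun r' => ?_)
    simp only [Function.comp_apply]
    congr 2
    module

/-- The Biot-Savart kernel is a pointwise derivative, but inside convolutions only its
almost-everywhere class matters. -/
lemma pderiv_green_ae (i : Fin 2) :
    pderiv i green =ᵐ[volume] fun x => ∫ t in Set.Ioi (0 : ℝ), heatGrad i t x := by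
  filter_upwards [ae_coord_ne_int] with x hx using (hasLineDerivAt_green hx i).lineDeriv

lemma locallyIntegrable_green : LocallyIntegrable green :=
  isTimeKernel_heatKernel_sub_one.locallyIntegrable

lemma torusConv_green {φ : Plane → ℝ} (hφ : IsTest φ) (x : Plane) :
    IntegrableOn (fun t => ∫ z, (heatKernel t z - 1) * φ (x - z)) (Set.Ioi 0) ∧
    torusConv green φ x = ∫ t in Set.Ioi (0 : ℝ), ∫ z, (heatKernel t z - 1) * φ (x - z) :=
  isTimeKernel_heatKernel_sub_one.torusConv_eq hφ x

lemma integral_heatKernel_sub_one_mul_pderiv {φ : Plane → ℝ} (hφ : IsTest φ) (i : Fin 2)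
    (x : Plane) {t : ℝ} (ht : 0 < t) :
    ∫ z, (heatKernel t z - 1) * pderiv i φ (x - z) = ∫ z, heatGrad i t z * φ (x - z) :=
  (integral_deriv_mul_sub ((continuous_heatKernel ht).sub continuous_const)
    (continuous_of_continuousOn_uncurry (continuousOn_heatGrad i) ht)
    (fun x => (hasLineDerivAt_heatKernel ht i x).sub_const 1) hφ x).symm

/-- The derivative is transferred at each fixed time, where the heat kernel is regular; Fubini on
both sides avoids integrating by parts against the singular G. -/
lemma torusConv_pderiv_green {φ : Plane → ℝ} (hφ : IsTest φ) (i : Fin 2) :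
    torusConv (pderiv i green) φ = torusConv green (pderiv i φ) := by
  funext x
  rw [(torusConv_green (hφ.pderiv i) x).2, torusConv_eq_sub fun _ => hφ.eq_zero]
  have h : ∫ z, pderiv i green z * φ (x - z) =
      ∫ z, (∫ t in Set.Ioi (0 : ℝ), heatGrad i t z) * φ (x - z) := by
    refine integral_congr_ae ?_
    filter_upwards [pderiv_green_ae i] with z hz
    rw [hz]
  rw [h, ← torusConv_eq_sub fun _ => hφ.eq_zero, ((isTimeKernel_heatGrad i).torusConv_eq hφ x).2]
  exact setIntegral_congr_fun measurableSet_Ioi fun t ht =>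
    (integral_heatKernel_sub_one_mul_pderiv hφ i x ht).symm

/-! ### The heat flow and the Poisson equation. -/

lemma exists_circle_bounds_of_le {ε : ℝ} (hε : 0 < ε) : ∃ C > 0, ∀ t ≥ ε, ∀ s : ℝ,
    |circleHeatKernel t s| ≤ C ∧ |circleHeatDeriv₂ t s| ≤ C := by
  have hnn (k : ℕ) : 0 ≤ ∑' n : ℤ, fourierBound k ε n :=
    tsum_nonneg fun n => by unfold fourierBound; positivity
  refine ⟨∑' n : ℤ, fourierBound 0 ε n + ∑' n : ℤ, fourierBound 2 ε n + 1,
    by linarith [hnn 0, hnn 2], fun t ht s => ⟨?_, ?_⟩⟩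
  · rw [circleHeatKernel_eq_fourier (hε.trans_le ht), ← Real.norm_eq_abs]
    refine (tsum_of_norm_bounded (summable_fourierBound 0 hε).hasSum fun n => ?_).trans
      (by linarith [hnn 2])
    rw [← one_mul (_ * Real.cos _)]
    exact norm_fourier_term_le ht (Real.abs_cos_le_one _) (by simp)
  · rw [circleHeatDeriv₂, ← Real.norm_eq_abs]
    exact (tsum_of_norm_bounded (summable_fourierBound 2 hε).hasSum fun n =>
      norm_fourier_term_le ht (Real.abs_cos_le_one _) (by simp)).trans (by linarith [hnn 0])

lemma hasDerivAt_heatFlow {φ : Plane → ℝ} (hφ : IsTest φ) (x : Plane) {t : ℝ} (ht : 0 < t) :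
    HasDerivAt (fun t => ∫ z, heatKernel t z * φ (x - z))
      (∫ z, (∑ i, heatHess i t z) * φ (x - z)) t := by
  obtain ⟨C, hC, h⟩ := exists_circle_bounds_of_le (half_pos ht)
  have hφc : Continuous fun z => φ (x - z) := hφ.continuous.comp (by fun_prop)
  have hhess (t : ℝ) (ht : 0 < t) : Continuous fun z => ∑ i, heatHess i t z :=
    continuous_finsetSum _ fun i _ =>
      continuous_of_continuousOn_uncurry (continuousOn_heatHess i) ht
  refine (hasDerivAt_integral_of_dominated_loc_of_deriv_le (𝕜 := ℝ) (μ := volume)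
    (F := fun t z => heatKernel t z * φ (x - z))
    (F' := fun t z => (∑ i, heatHess i t z) * φ (x - z)) (s := Set.Ioi (t / 2))
    (bound := fun z => 2 * C ^ 2 * |φ (x - z)|) (Ioi_mem_nhds (half_lt_self ht)) ?_ ?_ ?_ ?_ ?_
    ?_).2
  · filter_upwards [lt_mem_nhds ht] with r hr
    exact ((continuous_heatKernel hr).mul hφc).aestronglyMeasurable
  · exact hφ.integrable_mul_sub (continuous_heatKernel ht).locallyIntegrable x
  · exact ((hhess t ht).mul hφc).aestronglyMeasurable
  · refine Eventually.of_forall fun z r hr => ?_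
    rw [norm_mul, Real.norm_eq_abs, Real.norm_eq_abs]
    gcongr
    rw [Fin.sum_univ_two, heatHess, heatHess]
    refine (abs_add_le _ _).trans ?_
    rw [abs_mul, abs_mul, two_mul, sq]
    have hr' : t / 2 ≤ r := (Set.mem_Ioi.1 hr).le
    gcongr
    exacts [(h r hr' _).2, (h r hr' _).1, (h r hr' _).2, (h r hr' _).1]
  · exact ((hφ.integrable.comp_sub_left x).abs).const_mul _
  · refine Eventually.of_forall fun z r hr => ?_
    exact (hasDerivAt_heatKernel_time ((half_pos ht).trans hr) z).mul_const _

lemma tendsto_heatFlow_atTop {φ : Plane → ℝ} (hφ : IsTest φ) (x : Plane) :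
    Tendsto (fun t => ∫ z, heatKernel t z * φ (x - z)) atTop (𝓝 (∫ z, φ z)) := by
  obtain ⟨C, hC, h⟩ := exists_large_time_plane_le
  have hint : Integrable fun z => φ (x - z) := hφ.integrable.comp_sub_left x
  rw [← integral_sub_left_eq_self φ volume x, tendsto_iff_norm_sub_tendsto_zero]
  have hlim : Tendsto (fun t => C * Real.exp (-t) * ∫ z, |φ (x - z)|) atTop (𝓝 0) := by
    have := (Real.tendsto_exp_neg_atTop_nhds_zero.const_mul C).mul_const (∫ z, |φ (x - z)|)
    simpa using this
  refine squeeze_zero' (Eventually.of_forall fun _ => norm_nonneg _) ?_ hlim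
  filter_upwards [eventually_ge_atTop (1 : ℝ)] with t ht
  have h0 : 0 < t := by linarith
  rw [← integral_sub (hφ.integrable_mul_sub (continuous_heatKernel h0).locallyIntegrable x) hint,
    ← integral_const_mul]
  refine norm_integral_le_of_norm_le (hint.abs.const_mul _) (Eventually.of_forall fun z => ?_)
  have : heatKernel t z * φ (x - z) - φ (x - z) = (heatKernel t z - 1) * φ (x - z) := by ring
  rw [this, norm_mul, Real.norm_eq_abs, Real.norm_eq_abs]
  gcongr
  exact (h t ht z).1

lemma setIntegral_circleHeatKernel_sub {t : ℝ} (ht : 0 < t) (a : ℝ) :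
    ∫ s in Set.Ioo (-(1 / 2) : ℝ) (1 / 2), circleHeatKernel t (s - a) = 1 := by
  rw [← integral_Ioc_eq_integral_Ioo, ← intervalIntegral.integral_of_le (by norm_num),
    intervalIntegral.integral_comp_sub_right]
  have e : 1 / 2 - a = -(1 / 2) - a + 1 := by ring
  rw [e, integral_circleHeatKernel ht]

lemma setIntegral_heatKernel_sub {t : ℝ} (ht : 0 < t) (y : Plane) :
    ∫ x in box (1 / 2), heatKernel t (x - y) = 1 := by
  simp_rw [heatKernel_eq t _ 0, PiLp.sub_apply]
  rw [setIntegral_box_mul (fun s => circleHeatKernel t (s - y 0))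
    (fun s => circleHeatKernel t (s - y (Fin.rev 0))), setIntegral_circleHeatKernel_sub ht,
    setIntegral_circleHeatKernel_sub ht, mul_one]

lemma heatKernel_neg (t : ℝ) (x : Plane) : heatKernel t (-x) = heatKernel t x := by
  simp [heatKernel, circleHeatKernel_neg]

/-- The heat kernel is an approximate identity on the cell: nonnegative, of mass one, and uniformly
small off any neighbourhood of x. Interiority of x keeps the periodic images of the peak away. -/
lemma tendsto_heatFlow_zero {φ : Plane → ℝ} (hφ : IsTest φ) {x : Plane} (hx : x ∈ box (1 / 2)) :
    Tendsto (fun t => ∫ z, heatKernel t z * φ (x - z)) (𝓝[>] 0) (𝓝 (φ x)) := by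
  have he (t : ℝ) : ∫ z, heatKernel t z * φ (x - z) =
      ∫ y in box (1 / 2), heatKernel t (y - x) • φ y := by
    rw [← torusConv_eq_sub fun _ => hφ.eq_zero, torusConv, setIntegral_cell]
    congr 1
    funext y
    rw [← heatKernel_neg, neg_sub, smul_eq_mul]
  simp_rw [he]
  refine tendsto_setIntegral_peak_smul_of_integrableOn_of_tendsto (measurableSet_box _)
    (measurableSet_box _) subset_rfl self_mem_nhdsWithin (volume_box_lt_top _).ne
    (Eventually.of_forall fun t y _ => heatKernel_nonneg _ _) ?_ ?_ ?_ hφ.integrable.integrableOn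
    hφ.continuous.continuousWithinAt.tendsto
  · intro u hu hxu
    obtain ⟨r, hr, hru⟩ := Metric.isOpen_iff.1 hu x hxu
    -- η is the coordinate distance from x to the edge of the cell; then yᵢ − xᵢ stays η away from
    -- every nonzero integer for y in the cell.
    obtain ⟨η, hη, hxη⟩ : ∃ η > 0, ∀ i, |x i| ≤ 1 / 2 - η := by
      refine ⟨min (1 / 2 - |x 0|) (1 / 2 - |x 1|), lt_min (by linarith [abs_lt.2 (hx 0)])
        (by linarith [abs_lt.2 (hx 1)]), Fin.forall_fin_two.2 ⟨?_, ?_⟩⟩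
      · linarith [min_le_left (1 / 2 - |x 0|) (1 / 2 - |x 1|)]
      · linarith [min_le_right (1 / 2 - |x 0|) (1 / 2 - |x 1|)]
    obtain ⟨D, hD, haway⟩ := exists_circleHeatKernel_le_of_away (lt_min (div_pos hr three_pos) hη)
    obtain ⟨B, hB, hsmall⟩ := exists_circle_bounds
    rw [Metric.tendstoUniformlyOn_iff]
    intro ε hε
    have hlim : Tendsto (fun t : ℝ => B * D * √t) (𝓝[>] 0) (𝓝 0) := by
      have : Continuous fun t : ℝ => B * D * √t := by fun_prop
      have h := this.tendsto 0
      simp only [Real.sqrt_zero, mul_zero] at h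
      exact h.mono_left nhdsWithin_le_nhds
    filter_upwards [hlim.eventually_lt_const hε, Ioc_mem_nhdsGT one_pos] with t htε ht y hy
    have h0 := ht.1
    -- Otherwise ‖y − x‖ ≤ 2r/3 < r. The coordinate found contributes O(t), the other at most
    -- O(t^{−1/2}), so the product is O(√t).
    obtain ⟨i, hi⟩ : ∃ i, r / 3 ≤ |y i - x i| := by
      by_contra! hcon
      have hmem : y - x ∈ box (r / 3) := fun i => abs_lt.1 (hcon i)
      refine hy.2 (hru (mem_ball_iff_norm.2 ((norm_le_of_mem_box hmem).trans_lt ?_)))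
      linarith
    have hdist (n : ℤ) : min (r / 3) η ≤ |y i - x i - n| := by
      have hyi := abs_le.1 (abs_lt.2 (hy.1 i)).le
      have hxi := abs_le.1 (hxη i)
      rcases lt_trichotomy n 0 with hn | rfl | hn
      · have : (n : ℝ) ≤ -1 := by exact_mod_cast Int.le_sub_one_of_lt hn
        exact (min_le_right _ _).trans (le_abs.2 (Or.inl (by linarith)))
      · simpa using Or.inl hi
      · have : (1 : ℝ) ≤ n := by exact_mod_cast hn
        exact (min_le_right _ _).trans (le_abs.2 (Or.inr (by linarith)))
    rw [Pi.zero_apply, dist_zero_left, Real.norm_of_nonneg (heatKernel_nonneg _ _)]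
    refine lt_of_le_of_lt ?_ htε
    rw [heatKernel_eq _ _ i]
    calc _ ≤ (D * t) * (B * (√t)⁻¹) := by
          gcongr
          · exact circleHeatKernel_nonneg _ _
          · exact haway t ht _ hdist
          · exact (hsmall t ht _).1
      _ = B * D * √t := by
          have : √t ≠ 0 := (Real.sqrt_pos.2 h0).ne'
          nth_rewrite 1 [← Real.sq_sqrt h0.le]
          field_simp
  · refine tendsto_const_nhds.congr' ?_
    filter_upwards [self_mem_nhdsWithin] with t ht
    exact (setIntegral_heatKernel_sub ht x).symm
  · filter_upwards [self_mem_nhdsWithin] with t ht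
    exact ((continuous_heatKernel ht).comp (by fun_prop)).aestronglyMeasurable

/-- With the derivatives thrown back on the heat kernel, the time integrand is Δp_t ∗ φ = ∂ₜ(p_t ∗
φ) at x. The fundamental theorem of calculus leaves the limit at infinity, the mean of φ, minus the
limit at 0, which is φ(x). -/
lemma sum_torusConv_green_pderiv_pderiv {φ : Plane → ℝ} (hφ : IsTest φ) {x : Plane}
    (hx : x ∈ box (1 / 2)) :
    ∑ i, torusConv green (pderiv i (pderiv i φ)) x = (∫ z, φ z) - φ x := by
  have hA (i : Fin 2) {t : ℝ} (ht : 0 < t) :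
      ∫ z, (heatKernel t z - 1) * pderiv i (pderiv i φ) (x - z) =
        ∫ z, heatHess i t z * φ (x - z) := by
    rw [integral_heatKernel_sub_one_mul_pderiv (hφ.pderiv i) i x ht]
    exact (integral_deriv_mul_sub (continuous_of_continuousOn_uncurry (continuousOn_heatGrad i) ht)
      (continuous_of_continuousOn_uncurry (continuousOn_heatHess i) ht)
      (fun x => hasLineDerivAt_heatGrad ht i x) hφ x).symm
  have hB (i : Fin 2) := torusConv_green ((hφ.pderiv i).pderiv i) x
  have hsum : ∀ t ∈ Set.Ioi (0 : ℝ),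
      ∑ i, ∫ z, (heatKernel t z - 1) * pderiv i (pderiv i φ) (x - z) =
        ∫ z, (∑ i, heatHess i t z) * φ (x - z) := fun t ht => by
    simp_rw [Finset.sum_mul]
    rw [integral_finsetSum]
    · exact Finset.sum_congr rfl fun i _ => hA i ht
    · exact fun i _ => hφ.integrable_mul_sub (continuous_of_continuousOn_uncurry
        (continuousOn_heatHess i) ht).locallyIntegrable x
  rw [Finset.sum_congr rfl fun i _ => (hB i).2, ← integral_finsetSum _ fun i _ => (hB i).1,
    setIntegral_congr_fun measurableSet_Ioi hsum]
  -- The kernel formula is degenerate at t = 0, so the flow is given its limit there to be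
  -- continuous on [0, ∞).
  set F : ℝ → ℝ := Function.update (fun t => ∫ z, heatKernel t z * φ (x - z)) 0 (φ x) with hF
  have hFe (t : ℝ) (ht : t ≠ 0) : F t = ∫ z, heatKernel t z * φ (x - z) :=
    Function.update_of_ne ht _ _
  have h0 : F 0 = φ x := Function.update_self _ _ _
  rw [← h0]
  refine integral_Ioi_of_hasDerivAt_of_tendsto (f := F) ?_ (fun t ht => ?_) ?_ ?_
  · rw [← continuousWithinAt_Ioi_iff_Ici, ContinuousWithinAt, h0]
    refine (tendsto_heatFlow_zero hφ hx).congr' ?_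
    filter_upwards [self_mem_nhdsWithin] with t ht using (hFe t (ne_of_gt ht)).symm
  · refine (hasDerivAt_heatFlow hφ x ht).congr_of_eventuallyEq ?_
    filter_upwards [lt_mem_nhds (Set.mem_Ioi.1 ht)] with r hr using hFe r hr.ne'
  · exact (integrable_finsetSum _ fun i _ => (hB i).1).congr
      ((ae_restrict_mem measurableSet_Ioi).mono fun t ht => hsum t ht)
  · refine (tendsto_heatFlow_atTop hφ x).congr' ?_
    filter_upwards [eventually_gt_atTop 0] with t ht using (hFe t ht.ne').symm

lemma contDiff_torusConv_green {φ : Plane → ℝ} (hφ : IsTest φ) :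
    ContDiff ℝ ∞ (torusConv green φ) := by
  have h : torusConv green φ = convolution green φ (ContinuousLinearMap.mul ℝ ℝ) volume := by
    funext x
    rw [torusConv_eq_sub fun _ => hφ.eq_zero]
    rfl
  rw [h]
  exact hφ.compact.contDiff_convolution_right _ locallyIntegrable_green hφ.smooth

lemma pderiv_torusConv_green {φ : Plane → ℝ} (hφ : IsTest φ) (i : Fin 2) :
    pderiv i (torusConv green φ) = torusConv green (pderiv i φ) := by
  funext x
  rw [pderiv_eq_fderiv ((contDiff_torusConv_green hφ).differentiable (by simp) x)]
  have h : torusConv green φ = convolution green φ (ContinuousLinearMap.mul ℝ ℝ) volume := by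
    funext x
    rw [torusConv_eq_sub fun _ => hφ.eq_zero]
    rfl
  rw [h, (hφ.compact.hasFDerivAt_convolution_right (ContinuousLinearMap.mul ℝ ℝ)
    locallyIntegrable_green (hφ.smooth.of_le (by simp)) x).fderiv,
    convolution_precompR_apply _ locallyIntegrable_green (hφ.compact.fderiv ℝ)
      (hφ.smooth.continuous_fderiv (by simp)), torusConv_eq_sub fun _ => (hφ.pderiv i).eq_zero,
    hφ.pderiv_eq]
  rfl

lemma volume_real_box : volume.real (box (1 / 2)) = 1 := by
  have h := setIntegral_box_mul (fun _ => 1) (fun _ => 1) (1 / 2) 0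
  simp only [mul_one, integral_const, smul_eq_mul, measureReal_restrict_apply_univ,
    Real.volume_real_Ioo] at h
  norm_num at h ⊢
  exact h

/-- Each p_t − 1 has mean zero over a cell; Fubini applies with the indicator of the translated cell
as weight. -/
lemma setIntegral_green_sub (y : Plane) : ∫ x in box (1 / 2), green (x - y) = 0 := by
  have hind (f : Plane → ℝ) : ∫ x in box (1 / 2), f (x - y) =
      ∫ z, f z * (box (1 / 2)).indicator 1 (z + y) := by
    rw [← integral_indicator (measurableSet_box _), ← integral_add_right_eq_self _ y]
    congr 1
    funext z
    by_cases h : z + y ∈ box (1 / 2)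
    · rw [Set.indicator_of_mem h, Set.indicator_of_mem h, add_sub_cancel_right, Pi.one_apply,
        mul_one]
    · rw [Set.indicator_of_notMem h, Set.indicator_of_notMem h, mul_zero]
  obtain ⟨N, hN⟩ := exists_nat_gt (1 + ‖y‖)
  have hm : Measurable fun z => (box (1 / 2)).indicator (1 : Plane → ℝ) (z + y) :=
    (measurable_one.indicator (measurableSet_box _)).comp (measurable_add_const y)
  have hgreen : green = fun z => ∫ t in Set.Ioi (0 : ℝ), (heatKernel t z - 1) := rfl
  rw [hind, hgreen, (isTimeKernel_heatKernel_sub_one.integral_mul (M := 1) (N := N)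
    hm.aestronglyMeasurable (fun z => ?_) fun z hz => Set.indicator_of_notMem (fun h => hz ?_) _).2]
  · refine integral_eq_zero_of_ae ?_
    filter_upwards [ae_restrict_mem measurableSet_Ioi] with t ht
    rw [← hind fun z => heatKernel t z - 1, integral_sub
      (f := fun x => heatKernel t (x - y)) (g := fun _ => 1) (integrableOn_box
        ((continuous_heatKernel ht).comp (by fun_prop : Continuous fun x : Plane => x - y)) _)
      (integrable_const _),
      setIntegral_heatKernel_sub ht]
    simp only [integral_const, measureReal_restrict_apply_univ, smul_eq_mul, mul_one]
    rw [volume_real_box, sub_self]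
    rfl
  · by_cases h : z + y ∈ box (1 / 2)
    · rw [Set.indicator_of_mem h]; simp
    · rw [Set.indicator_of_notMem h]; simp
  · refine mem_box_of_norm_lt (lt_of_le_of_lt ?_ hN)
    have h1 := norm_le_of_mem_box h
    have h2 := norm_sub_le (z + y) y
    rw [add_sub_cancel_right] at h2
    linarith

lemma setIntegral_torusConv_green {φ : Plane → ℝ} (hφ : IsTest φ) :
    ∫ x in box (1 / 2), torusConv green φ x = 0 := by
  -- G is only locally integrable; differences of points of the cell lie in `box 1`, so this
  -- truncation changes nothing and makes Fubini available.
  have hg : Integrable ((box 1).indicator green) := by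
    refine (integrable_indicator_iff (measurableSet_box _)).2 ?_
    exact (locallyIntegrable_green.integrableOn_isCompact
      (isBounded_box 1).isCompact_closure).mono_set subset_closure
  have hint := Integrable.convolution_integrand (ContinuousLinearMap.mul ℝ ℝ)
    (μ := (volume : Measure Plane)) (ν := volume) hφ.integrable hg
  have hint' := hint.mono_measure (μ := (volume.restrict (box (1 / 2))).prod volume)
    (Measure.prod_mono Measure.restrict_le_self le_rfl)
  have he : ∀ x ∈ box (1 / 2), torusConv green φ x =
      ∫ y, φ y * (box 1).indicator green (x - y) := fun x hx => by
    rw [torusConv_eq fun _ => hφ.eq_zero]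
    congr 1
    funext y
    by_cases hy : y ∈ box (1 / 2)
    · rw [Set.indicator_of_mem, mul_comm]
      intro i
      have h1 := hx i
      have h2 := hy i
      exact ⟨by simp only [PiLp.sub_apply]; linarith [h1.1, h2.2],
        by simp only [PiLp.sub_apply]; linarith [h1.2, h2.1]⟩
    · rw [hφ.eq_zero hy, mul_zero, zero_mul]
  rw [setIntegral_congr_fun (measurableSet_box _) he,
    integral_integral_swap (f := fun x y => φ y * (box 1).indicator green (x - y)) hint']
  refine integral_eq_zero_of_ae (Eventually.of_forall fun y => ?_)
  simp only [Pi.zero_apply]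
  rw [integral_const_mul]
  by_cases hy : y ∈ box (1 / 2)
  · have : ∫ x in box (1 / 2), (box 1).indicator green (x - y) =
        ∫ x in box (1 / 2), green (x - y) := by
      refine setIntegral_congr_fun (measurableSet_box _) fun x hx => Set.indicator_of_mem ?_ _
      intro i
      have h1 := hx i
      have h2 := hy i
      exact ⟨by simp only [PiLp.sub_apply]; linarith [h1.1, h2.2],
        by simp only [PiLp.sub_apply]; linarith [h1.2, h2.1]⟩
    rw [this, setIntegral_green_sub, mul_zero]
  · rw [hφ.eq_zero hy, zero_mul]

/-! ### Integration by parts for periodic functions. -/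

/-- Smooth functions on the torus. -/
structure IsSmoothPeriodic (f : Plane → ℝ) : Prop where
  smooth : ContDiff ℝ ∞ f
  periodic : ∀ i x, f (x + unitVec i) = f x

lemma setIntegral_box_iterated {F : Plane → ℝ} (hF : Continuous F) (R : ℝ) (i : Fin 2) :
    ∫ x in box R, F x = ∫ a in Set.Ioo (-R) R, ∫ b in Set.Ioo (-R) R,
      F (a • unitVec i.rev + b • unitVec i) := by
  have hG : Continuous fun p : ℝ × ℝ => F (p.1 • unitVec 0 + p.2 • unitVec 1) := by fun_prop
  have hint : IntegrableOn (fun p : ℝ × ℝ => F (p.1 • unitVec 0 + p.2 • unitVec 1))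
      (Set.Ioo (-R) R ×ˢ Set.Ioo (-R) R) (volume.prod volume) :=
    (hG.locallyIntegrable.integrableOn_isCompact (isCompact_Icc.prod isCompact_Icc)).mono_set
      (Set.prod_mono Set.Ioo_subset_Icc_self Set.Ioo_subset_Icc_self)
  have h := setIntegral_box (fun p : ℝ × ℝ => F (p.1 • unitVec 0 + p.2 • unitVec 1)) R
  have hx (x : Plane) : x 0 • unitVec 0 + x 1 • unitVec 1 = x := by
    ext j
    fin_cases j <;> simp [unitVec]
  simp only [hx] at h
  rw [h]
  fin_cases i
  · refine (setIntegral_prod_swap _ _ _).symm.trans ((setIntegral_prod _ hint.swap).trans ?_)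
    simp only
    congr 1
    funext a
    congr 1
    funext b
    rw [add_comm]
    rfl
  · exact setIntegral_prod _ hint

namespace IsSmoothPeriodic

variable {f g : Plane → ℝ}

lemma differentiable (hf : IsSmoothPeriodic f) : Differentiable ℝ f :=
  hf.smooth.differentiable (by simp)

lemma continuous (hf : IsSmoothPeriodic f) : Continuous f := hf.smooth.continuous

lemma pderiv_eq (hf : IsSmoothPeriodic f) (i : Fin 2) :
    pderiv i f = fun x => fderiv ℝ f x (unitVec i) :=
  funext fun x => pderiv_eq_fderiv (hf.differentiable x) i

lemma pderiv (hf : IsSmoothPeriodic f) (i : Fin 2) : IsSmoothPeriodic (pderiv i f) where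
  smooth := by
    rw [hf.pderiv_eq]
    exact (hf.smooth.fderiv_right (m := ∞) (by simp)).clm_apply contDiff_const
  periodic j x := by
    simp only [VortexNoise.pderiv, lineDeriv]
    congr 1
    funext r
    rw [add_right_comm, hf.periodic]

lemma mul (hf : IsSmoothPeriodic f) (hg : IsSmoothPeriodic g) :
    IsSmoothPeriodic fun x => f x * g x :=
  ⟨hf.smooth.mul hg.smooth, fun i x => by rw [hf.periodic, hg.periodic]⟩

lemma integrableOn (hf : IsSmoothPeriodic f) : IntegrableOn f (box (1 / 2)) :=
  integrableOn_box hf.continuous _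

lemma hasDerivAt (hf : IsSmoothPeriodic f) (i : Fin 2) (x : Plane) (r : ℝ) :
    HasDerivAt (fun r => f (x + r • unitVec i)) (VortexNoise.pderiv i f (x + r • unitVec i)) r := by
  rw [hf.pderiv_eq]
  have h := (hf.differentiable (x + r • unitVec i)).hasFDerivAt.comp_hasDerivAt r
    (((hasDerivAt_id r).smul_const (unitVec i)).const_add x)
  exact h.congr_deriv (by simp)

/-- With direction i as the inner integral, the boundary terms on opposite sides cancel by
periodicity. -/
lemma setIntegral_pderiv (hf : IsSmoothPeriodic f) (i : Fin 2) :
    ∫ x in box (1 / 2), VortexNoise.pderiv i f x = 0 := by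
  rw [setIntegral_box_iterated (hf.pderiv i).continuous _ i]
  refine integral_eq_zero_of_ae (Eventually.of_forall fun a => ?_)
  have hc := (hf.pderiv i).continuous
  simp only [Pi.zero_apply]
  rw [← integral_Ioc_eq_integral_Ioo, ← intervalIntegral.integral_of_le (by norm_num),
    intervalIntegral.integral_eq_sub_of_hasDerivAt (fun r _ => hf.hasDerivAt i _ r)
      (Continuous.intervalIntegrable (by fun_prop) _ _), sub_eq_zero,
    ← hf.periodic i (_ + (-(1 / 2) : ℝ) • unitVec i)]
  congr 1
  module

lemma pderiv_mul (hf : IsSmoothPeriodic f) (hg : IsSmoothPeriodic g) (i : Fin 2) (x : Plane) :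
    VortexNoise.pderiv i (fun x => f x * g x) x =
      VortexNoise.pderiv i f x * g x + f x * VortexNoise.pderiv i g x := by
  have h := (hf.hasDerivAt i x 0).mul (hg.hasDerivAt i x 0)
  simp only [zero_smul, add_zero] at h
  exact HasLineDerivAt.lineDeriv h

lemma setIntegral_pderiv_mul (hf : IsSmoothPeriodic f) (hg : IsSmoothPeriodic g) (i : Fin 2) :
    ∫ x in box (1 / 2), VortexNoise.pderiv i f x * g x =
      -∫ x in box (1 / 2), f x * VortexNoise.pderiv i g x := by
  have h := (hf.mul hg).setIntegral_pderiv i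
  simp_rw [hf.pderiv_mul hg] at h
  rw [integral_add ((hf.pderiv i).mul hg).integrableOn (hf.mul (hg.pderiv i)).integrableOn] at h
  linarith

end IsSmoothPeriodic

lemma heatKernel_add_unitVec (t : ℝ) (x : Plane) (i : Fin 2) :
    heatKernel t (x + unitVec i) = heatKernel t x := by
  have h := circleHeatKernel_add_int t (x i) 1
  rw [← one_smul ℝ (unitVec i), heatKernel_eq t _ i, add_smul_unitVec_self, add_smul_unitVec_rev,
    heatKernel_eq t x i, ← h, Int.cast_one]

lemma isSmoothPeriodic_torusConv_green {φ : Plane → ℝ} (hφ : IsTest φ) :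
    IsSmoothPeriodic (torusConv green φ) := by
  refine ⟨contDiff_torusConv_green hφ, fun i x => ?_⟩
  simp only [torusConv, add_sub_right_comm, green, heatKernel_add_unitVec]

/-! ### Symmetries of the square lattice. -/

/-- The reflection of the plane in the second coordinate axis. -/
def reflection : Plane ≃ₗᵢ[ℝ] Plane :=
  LinearIsometryEquiv.piLpCongrRight 2
    fun i => if i = 0 then LinearIsometryEquiv.neg ℝ else LinearIsometryEquiv.refl ℝ ℝ

/-- The exchange of the two coordinates of the plane. -/
def exchange : Plane ≃ₗᵢ[ℝ] Plane :=
  LinearIsometryEquiv.piLpCongrLeft 2 ℝ ℝ (Equiv.swap 0 1)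

lemma reflection_apply_zero (x : Plane) : reflection x 0 = -x 0 := rfl

lemma reflection_apply_one (x : Plane) : reflection x 1 = x 1 := rfl

lemma exchange_apply (x : Plane) (i : Fin 2) : exchange x i = x i.rev := by
  fin_cases i <;> rfl

lemma reflection_unitVec_zero : reflection (unitVec 0) = (-1 : ℝ) • unitVec 0 := by
  ext i
  fin_cases i
  · exact (reflection_apply_zero _).trans (by simp)
  · exact (reflection_apply_one _).trans (by simp [unitVec])

lemma reflection_unitVec_one : reflection (unitVec 1) = (1 : ℝ) • unitVec 1 := by
  ext i
  fin_cases i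
  · exact (reflection_apply_zero _).trans (by simp [unitVec])
  · exact (reflection_apply_one _).trans (by simp)

lemma exchange_unitVec (i : Fin 2) : exchange (unitVec i) = (1 : ℝ) • unitVec i.rev := by
  ext j
  rw [exchange_apply]
  fin_cases i <;> fin_cases j <;> simp [unitVec]

lemma neg_unitVec (i : Fin 2) : LinearIsometryEquiv.neg ℝ (unitVec i) = (-1 : ℝ) • unitVec i := by
  simp

/-- The isometries of the plane that respect the square lattice. -/
structure IsLatticeIsometry (T : Plane ≃ₗᵢ[ℝ] Plane) : Prop where
  mem_box : ∀ R x, T x ∈ box R ↔ x ∈ box R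
  heatKernel : ∀ t x, heatKernel t (T x) = heatKernel t x

lemma isLatticeIsometry_reflection : IsLatticeIsometry reflection where
  mem_box R x := by
    simp only [box, Set.mem_ofPred_eq, Fin.forall_fin_two, reflection_apply_zero,
      reflection_apply_one, Set.mem_Ioo]
    constructor <;> rintro ⟨⟨h1, h2⟩, h3⟩ <;> exact ⟨⟨by linarith, by linarith⟩, h3⟩
  heatKernel t x := by
    simp only [heatKernel, Fin.prod_univ_two, reflection_apply_zero, reflection_apply_one,
      circleHeatKernel_neg]

lemma isLatticeIsometry_exchange : IsLatticeIsometry exchange where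
  mem_box R x := by
    simp only [box, Set.mem_ofPred_eq, Fin.forall_fin_two, exchange_apply]
    exact and_comm
  heatKernel t x := by
    simp only [heatKernel, Fin.prod_univ_two, exchange_apply]
    exact mul_comm _ _

lemma isLatticeIsometry_neg : IsLatticeIsometry (LinearIsometryEquiv.neg ℝ) where
  mem_box R x := by
    simp only [box, Set.mem_ofPred_eq, LinearIsometryEquiv.coe_neg, PiLp.neg_apply, Set.mem_Ioo]
    refine forall_congr' fun i => ?_
    constructor <;> rintro ⟨h1, h2⟩ <;> exact ⟨by linarith, by linarith⟩
  heatKernel t x := heatKernel_neg t x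

namespace IsLatticeIsometry

variable {T : Plane ≃ₗᵢ[ℝ] Plane}

lemma setIntegral_comp (hT : IsLatticeIsometry T) (f : Plane → ℝ) (R : ℝ) :
    ∫ x in box R, f (T x) = ∫ x in box R, f x := by
  have : T ⁻¹' box R = box R := Set.ext fun x => hT.mem_box R x
  nth_rewrite 1 [← this]
  exact T.measurePreserving.setIntegral_preimage_emb T.toHomeomorph.measurableEmbedding f _

lemma torusConv_green_comp (hT : IsLatticeIsometry T) {φ : Plane → ℝ}
    (hφ : ∀ x, φ (T x) = φ x) (x : Plane) :
    torusConv green φ (T x) = torusConv green φ x := by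
  rw [torusConv, torusConv, setIntegral_cell, setIntegral_cell, ← hT.setIntegral_comp]
  simp only [hφ, ← map_sub, green, hT.heatKernel]

end IsLatticeIsometry

/-- The factor c in the hypothesis has the same shape as the factor in the conclusion, so the rule
can be iterated to get second derivatives. -/
lemma pderiv_comp_isometry {T : Plane ≃ₗᵢ[ℝ] Plane} {f g : Plane → ℝ} {c a : ℝ} {i j : Fin 2}
    (hf : ∀ x, g (T x) = c * f x) (hT : T (unitVec i) = a • unitVec j) (ha : a * a = 1)
    (x : Plane) : pderiv j g (T x) = (a * c) * pderiv i f x := by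
  have h : a * pderiv j g (T x) = lineDeriv ℝ g (T x) (a • unitVec j) := by
    rw [lineDeriv_smul]
    rfl
  have h2 : lineDeriv ℝ g (T x) (a • unitVec j) = c * pderiv i f x := by
    rw [← hT, pderiv, lineDeriv, lineDeriv]
    simp_rw [← map_smul, ← map_add, hf]
    exact deriv_const_mul_field c
  calc pderiv j g (T x) = (a * a) * pderiv j g (T x) := by rw [ha, one_mul]
    _ = _ := by rw [mul_assoc, h, h2, mul_assoc]

/-! ### Energy identities. -/

/-- Radially symmetric probability densities with smooth profile, supported in the cell. -/
structure IsRadialTest (φ : Plane → ℝ) : Prop extends IsTest φ where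
  nonneg : ∀ x, 0 ≤ φ x
  mass : ∫ x, φ x = 1
  radial : ∀ (T : Plane ≃ₗᵢ[ℝ] Plane) (x : Plane), φ (T x) = φ x

/-- The Green energy `∫ φ (G ∗ ψ)`. -/
def energy (φ ψ : Plane → ℝ) : ℝ := ∫ x, φ x * torusConv green ψ x

lemma IsTest.setIntegral_mul {φ : Plane → ℝ} (hφ : IsTest φ) (f : Plane → ℝ) :
    ∫ x in box (1 / 2), φ x * f x = ∫ x, φ x * f x :=
  setIntegral_eq_integral_of_forall_compl_eq_zero fun x hx => by rw [hφ.eq_zero hx, zero_mul]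

namespace IsRadialTest

variable {φ ψ : Plane → ℝ}

lemma periodic (hφ : IsRadialTest φ) : IsSmoothPeriodic (torusConv green φ) :=
  isSmoothPeriodic_torusConv_green hφ.toIsTest

lemma torusConv_comp (hφ : IsRadialTest φ) {T : Plane ≃ₗᵢ[ℝ] Plane} (hT : IsLatticeIsometry T)
    (x : Plane) : torusConv green φ (T x) = 1 * torusConv green φ x := by
  rw [one_mul]
  exact hT.torusConv_green_comp (hφ.radial T) x

lemma torusConv_neg (hφ : IsRadialTest φ) (x : Plane) :
    torusConv green φ (-x) = torusConv green φ x :=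
  (hφ.torusConv_comp isLatticeIsometry_neg x).trans (one_mul _)

lemma pderiv_neg (hφ : IsRadialTest φ) (i : Fin 2) (x : Plane) :
    pderiv i (torusConv green φ) (-x) = -pderiv i (torusConv green φ) x := by
  have h := pderiv_comp_isometry (hφ.torusConv_comp isLatticeIsometry_neg) (neg_unitVec i)
    (by norm_num) x
  simpa using h

lemma pderiv_pderiv_neg (hφ : IsRadialTest φ) (i j : Fin 2) (x : Plane) :
    pderiv j (pderiv i (torusConv green φ)) (-x) = pderiv j (pderiv i (torusConv green φ)) x := by
  have h := pderiv_comp_isometry (pderiv_comp_isometry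
    (hφ.torusConv_comp isLatticeIsometry_neg) (neg_unitVec i) (by norm_num)) (neg_unitVec j)
    (by norm_num) x
  simpa using h

lemma laplacian (hφ : IsRadialTest φ) {x : Plane} (hx : x ∈ box (1 / 2)) :
    ∑ i, pderiv i (pderiv i (torusConv green φ)) x = 1 - φ x := by
  rw [← hφ.mass, ← sum_torusConv_green_pderiv_pderiv hφ.toIsTest hx]
  simp_rw [pderiv_torusConv_green hφ.toIsTest, pderiv_torusConv_green (hφ.toIsTest.pderiv _)]

/-- The mixed derivative is odd under x₀ ↦ −x₀ while G ∗ ψ is even, so the integral equals its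
negative. -/
lemma setIntegral_mixed (hφ : IsRadialTest φ) (hψ : IsRadialTest ψ) {i j : Fin 2} (hij : i ≠ j) :
    ∫ x in box (1 / 2), pderiv j (pderiv i (torusConv green φ)) x * torusConv green ψ x = 0 := by
  have hR := isLatticeIsometry_reflection
  have key (h : ∀ x, pderiv j (pderiv i (torusConv green φ)) (reflection x) =
      -pderiv j (pderiv i (torusConv green φ)) x) :
      ∫ x in box (1 / 2), pderiv j (pderiv i (torusConv green φ)) x * torusConv green ψ x = 0 := by
    have h1 := hR.setIntegral_comp
      (fun x => pderiv j (pderiv i (torusConv green φ)) x * torusConv green ψ x) (1 / 2)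
    simp only [h, hψ.torusConv_comp hR, one_mul, neg_mul, integral_neg] at h1
    linarith
  have h0 := hφ.torusConv_comp hR
  apply key
  intro x
  fin_cases i <;> fin_cases j
  · exact absurd rfl hij
  · have := pderiv_comp_isometry (pderiv_comp_isometry h0 reflection_unitVec_zero (by norm_num))
      reflection_unitVec_one (by norm_num) x
    simpa using this
  · have := pderiv_comp_isometry (pderiv_comp_isometry h0 reflection_unitVec_one (by norm_num))
      reflection_unitVec_zero (by norm_num) x
    simpa using this
  · exact absurd rfl hij

/-- Exchanging coordinates makes the two integrals equal. They add up to ∫ (1 − φ)(G ∗ ψ) = −E(φ,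
ψ), as G ∗ ψ has mean zero. -/
lemma setIntegral_pure (hφ : IsRadialTest φ) (hψ : IsRadialTest ψ) (i : Fin 2) :
    ∫ x in box (1 / 2), pderiv i (pderiv i (torusConv green φ)) x * torusConv green ψ x =
      -(energy φ ψ) / 2 := by
  have hS := isLatticeIsometry_exchange
  have hsymm (i : Fin 2) :
      ∫ x in box (1 / 2), pderiv i (pderiv i (torusConv green φ)) x * torusConv green ψ x =
      ∫ x in box (1 / 2), pderiv i.rev (pderiv i.rev (torusConv green φ)) x *
        torusConv green ψ x := by
    rw [← hS.setIntegral_comp (fun x =>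
      pderiv i.rev (pderiv i.rev (torusConv green φ)) x * torusConv green ψ x)]
    refine setIntegral_congr_fun (measurableSet_box _) fun x _ => ?_
    have := pderiv_comp_isometry (i := i) (j := i.rev) (a := 1) (pderiv_comp_isometry (i := i)
      (j := i.rev) (a := 1) (hφ.torusConv_comp hS) (exchange_unitVec i) (by norm_num))
      (exchange_unitVec i) (by norm_num) x
    simp only [this, hψ.torusConv_comp hS, one_mul]
  have hint (i : Fin 2) := (((hφ.periodic.pderiv i).pderiv i).mul hψ.periodic).integrableOn
  have hsum : (∫ x in box (1 / 2), pderiv 0 (pderiv 0 (torusConv green φ)) x *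
      torusConv green ψ x) + ∫ x in box (1 / 2), pderiv 1 (pderiv 1 (torusConv green φ)) x *
        torusConv green ψ x = -energy φ ψ := by
    rw [← integral_add (hint 0) (hint 1)]
    have h : ∀ x ∈ box (1 / 2), pderiv 0 (pderiv 0 (torusConv green φ)) x * torusConv green ψ x +
        pderiv 1 (pderiv 1 (torusConv green φ)) x * torusConv green ψ x =
        torusConv green ψ x - φ x * torusConv green ψ x := fun x hx => by
      have := hφ.laplacian hx
      rw [Fin.sum_univ_two] at this
      rw [← add_mul, this]
      ring
    rw [setIntegral_congr_fun (measurableSet_box _) h, integral_sub hψ.periodic.integrableOn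
      (g := fun x => φ x * torusConv green ψ x)
      (integrableOn_box (hφ.continuous.mul hψ.periodic.continuous) _),
      setIntegral_torusConv_green hψ.toIsTest, hφ.toIsTest.setIntegral_mul, zero_sub, energy]
  have h01 : ∫ x in box (1 / 2), pderiv 0 (pderiv 0 (torusConv green φ)) x *
      torusConv green ψ x = ∫ x in box (1 / 2), pderiv 1 (pderiv 1 (torusConv green φ)) x *
        torusConv green ψ x := hsymm 0
  fin_cases i <;> simp only [Fin.zero_eta, Fin.mk_one] <;> linarith

lemma setIntegral_pderiv_mul_pderiv (hφ : IsRadialTest φ) (hψ : IsRadialTest ψ) (i j : Fin 2) :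
    ∫ x in box (1 / 2), pderiv i (torusConv green φ) x * pderiv j (torusConv green ψ) x =
      if i = j then energy φ ψ / 2 else 0 := by
  have h := (hφ.periodic.pderiv i).setIntegral_pderiv_mul hψ.periodic j
  rw [← neg_eq_iff_eq_neg] at h
  rw [← h]
  split_ifs with hij
  · subst hij
    rw [setIntegral_pure hφ hψ]
    ring
  · rw [setIntegral_mixed hφ hψ hij, neg_zero]

lemma energy_self_eq (hφ : IsRadialTest φ) : energy φ φ =
    ∫ x in box (1 / 2), ∑ i, pderiv i (torusConv green φ) x ^ 2 := by
  simp_rw [sq]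
  rw [integral_finsetSum _ fun i _ =>
    ((hφ.periodic.pderiv i).mul (hφ.periodic.pderiv i)).integrableOn]
  simp_rw [setIntegral_pderiv_mul_pderiv hφ hφ]
  simp only [if_true, Fin.sum_univ_two]
  ring

/-- If the Dirichlet energy vanished, ∇(G ∗ φ) would be zero on the cell, and the Poisson equation
would force φ = 1 there. -/
lemma energy_self_pos (hφ : IsRadialTest φ) : 0 < energy φ φ := by
  have hsmooth := fun i => (hφ.periodic.pderiv i).continuous
  rw [energy_self_eq hφ]
  refine lt_of_le_of_ne (integral_nonneg fun x => by positivity) fun h0 => ?_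
  have hcont : Continuous fun x => ∑ i, pderiv i (torusConv green φ) x ^ 2 := by fun_prop
  have hae := (setIntegral_eq_zero_iff_of_nonneg_ae
    (Eventually.of_forall fun x => by positivity) (integrableOn_box hcont (1 / 2))).1 h0.symm
  have hzero : Set.EqOn (fun x => ∑ i, pderiv i (torusConv green φ) x ^ 2) 0 (box (1 / 2)) :=
    Measure.eqOn_open_of_ae_eq hae (isOpen_box _) hcont.continuousOn continuousOn_const
  have hgrad (i : Fin 2) : ∀ x ∈ box (1 / 2), pderiv i (torusConv green φ) x = 0 := fun x hx => by
    have := (Finset.sum_eq_zero_iff_of_nonneg fun i _ => sq_nonneg _).1 (hzero hx) i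
      (Finset.mem_univ i)
    exact pow_eq_zero_iff (two_ne_zero) |>.1 this
  have hone : ∀ x ∈ box (1 / 2), φ x = 1 := fun x hx => by
    have hlap := hφ.laplacian hx
    rw [Finset.sum_eq_zero fun i _ => ?_] at hlap
    · linarith
    · have he : pderiv i (torusConv green φ) =ᶠ[𝓝 x] fun _ => 0 := by
        filter_upwards [(isOpen_box _).mem_nhds hx] with y hy using hgrad i y hy
      rw [pderiv_eq_fderiv ((hφ.periodic.pderiv i).differentiable x), he.fderiv_eq]
      simp
  -- A closed support equal to the open square would be a proper nonempty clopen subset of the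
  -- connected plane.
  have hbox : tsupport φ = box (1 / 2) := Set.Subset.antisymm hφ.support fun x hx =>
    subset_tsupport _ (by rw [Function.mem_support, hone x hx]; exact one_ne_zero)
  have hclopen : IsClopen (box (1 / 2)) := ⟨hbox ▸ isClosed_tsupport φ, isOpen_box _⟩
  have huniv := hclopen.eq_univ ⟨0, fun i => by simp⟩
  have hmem : unitVec 0 ∈ box (1 / 2) := huniv ▸ Set.mem_univ _
  have := (hmem 0).2
  norm_num [unitVec] at this

end IsRadialTest

lemma torusConv_biotSavart_zero {φ : Plane → ℝ} (hφ : IsTest φ) :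
    torusConv (biotSavart 0) φ = fun x => -pderiv 1 (torusConv green φ) x := by
  funext x
  rw [pderiv_torusConv_green hφ, ← torusConv_pderiv_green hφ, torusConv, torusConv,
    ← integral_neg]
  simp [biotSavart]

lemma torusConv_biotSavart_one {φ : Plane → ℝ} (hφ : IsTest φ) :
    torusConv (biotSavart 1) φ = pderiv 0 (torusConv green φ) := by
  rw [pderiv_torusConv_green hφ, ← torusConv_pderiv_green hφ]
  rfl

/-- The velocity is the rotated gradient of G ∗ φ, so its L² norm squared is the Dirichlet energy.
-/
lemma velocityNorm_eq {φ : Plane → ℝ} (hφ : IsRadialTest φ) :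
    velocityNorm φ = √(energy φ φ) := by
  rw [velocityNorm, setIntegral_cell, hφ.energy_self_eq]
  simp_rw [Fin.sum_univ_two, torusConv_biotSavart_zero hφ.toIsTest,
    torusConv_biotSavart_one hφ.toIsTest, neg_sq]
  simp_rw [add_comm]

lemma isRadialTest_rescale {θ : Plane → ℝ} (hθ : IsRadialDensity θ) {l : ℝ}
    (hl : l ∈ Set.Ioo (0 : ℝ) 1) : IsRadialTest (rescale l θ) where
  smooth := contDiff_const.mul (hθ.smooth.comp (contDiff_const_smul _))
  compact := (hθ.compact_support.comp_smul (inv_ne_zero hl.1.ne')).mul_left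
  support := by
    intro x hx
    have h1 : tsupport (rescale l θ) ⊆ tsupport fun x => θ (l⁻¹ • x) :=
      closure_mono (Function.support_mul_subset_right _ _)
    have h2 := tsupport_comp_subset_preimage θ (f := fun x : Plane => l⁻¹ • x) (by fun_prop) (h1 hx)
    have h3 := hθ.support_subset h2
    intro i
    have h4 := h3 i
    simp only [PiLp.smul_apply, smul_eq_mul] at h4
    have h5 : x i = l * (l⁻¹ * x i) := by field_simp [hl.1.ne']
    rw [h5]
    have h6 := hl.1
    have h7 := hl.2
    constructor <;> nlinarith [h4.1, h4.2]
  nonneg x := mul_nonneg (by positivity) (hθ.nonneg _)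
  mass := by
    simp only [rescale]
    rw [integral_const_mul, Measure.integral_comp_inv_smul, hθ.integral_eq_one]
    have h1 := hl.1.ne'
    simp
    field_simp
  radial T x := by
    simp only [rescale, ← map_smul]
    rw [hθ.radial _ (l⁻¹ • x) (T.norm_map _)]

/-! ### Logarithmic asymptotics of the energy. -/

/-- The cross-correlation `z ↦ ∫ φ(x) ψ(x - z) dx`. -/
def correlation (φ ψ : Plane → ℝ) (z : Plane) : ℝ := ∫ x, φ x * ψ (x - z)

lemma stronglyMeasurable_correlation {φ ψ : Plane → ℝ} (hφ : Continuous φ) (hψ : Continuous ψ) :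
    StronglyMeasurable (correlation φ ψ) :=
  (Continuous.stronglyMeasurable (f := fun p : Plane × Plane => φ p.2 * ψ (p.2 - p.1))
    (by fun_prop)).integral_prod_right'

lemma correlation_eq_zero {φ ψ : Plane → ℝ} {R S : ℝ} (hφ : ∀ x ∉ box R, φ x = 0)
    (hψ : ∀ x ∉ box S, ψ x = 0) {z : Plane} (hz : z ∉ box (R + S)) : correlation φ ψ z = 0 := by
  refine integral_eq_zero_of_ae (Eventually.of_forall fun x => ?_)
  by_contra h
  obtain ⟨h1, h2⟩ := mul_ne_zero_iff.1 h
  have h1' := not_imp_comm.1 (hφ x) h1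
  have h2' := not_imp_comm.1 (hψ (x - z)) h2
  refine hz fun i => ?_
  have h3 := h1' i
  have h4 := h2' i
  simp only [PiLp.sub_apply] at h4
  exact ⟨by linarith [h3.1, h4.2], by linarith [h3.2, h4.1]⟩

lemma abs_correlation_le {φ ψ : Plane → ℝ} (hφ : IsRadialTest φ) {M : ℝ}
    (hM : ∀ x, |ψ x| ≤ M) (z : Plane) : |correlation φ ψ z| ≤ M := by
  have h := norm_integral_le_of_norm_le (f := fun x => φ x * ψ (x - z))
    (hφ.toIsTest.integrable.mul_const M) (Eventually.of_forall fun x => by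
      rw [norm_mul, Real.norm_of_nonneg (hφ.nonneg x)]
      exact mul_le_mul_of_nonneg_left (hM _) (hφ.nonneg x))
  rwa [integral_mul_const, hφ.mass, one_mul] at h

lemma integral_mul_integral_mul_sub {f φ ψ : Plane → ℝ} (hf : LocallyIntegrable f)
    (hφ : IsTest φ) (hψ : IsTest ψ) :
    ∫ x, φ x * ∫ z, f z * ψ (x - z) = ∫ z, f z * correlation φ ψ z := by
  -- Only z in `box 1` contributes when x and x − z both lie in the cell, so the truncation is
  -- harmless.
  have hg : Integrable ((box 1).indicator f) := by
    refine (integrable_indicator_iff (measurableSet_box _)).2 ?_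
    exact (hf.integrableOn_isCompact (isBounded_box 1).isCompact_closure).mono_set subset_closure
  obtain ⟨M, -, hM⟩ := hφ.exists_bound
  have hint := (Integrable.convolution_integrand (ContinuousLinearMap.mul ℝ ℝ)
    (μ := (volume : Measure Plane)) (ν := volume) hg hψ.integrable).bdd_mul (c := M)
    (f := fun p => φ p.1) (hφ.continuous.comp continuous_fst).aestronglyMeasurable
    (Eventually.of_forall fun p => hM p.1)
  have he (x z : Plane) : φ x * ((box 1).indicator f z * ψ (x - z)) =
      φ x * (f z * ψ (x - z)) := by
    by_cases hz : z ∈ box 1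
    · rw [Set.indicator_of_mem hz]
    · by_cases hx : x ∈ box (1 / 2)
      · have hxz : x - z ∉ box (1 / 2) := fun h => hz fun i => by
          have h1 := hx i
          have h2 := h i
          simp only [PiLp.sub_apply] at h2
          exact ⟨by linarith [h1.1, h2.2], by linarith [h1.2, h2.1]⟩
        simp only [hψ.eq_zero hxz, mul_zero]
      · rw [hφ.eq_zero hx, zero_mul, zero_mul]
  have hswap := integral_integral_swap
    (f := fun x z => φ x * ((box 1).indicator f z * ψ (x - z))) hint
  simp only [he] at hswap
  simp_rw [← integral_const_mul]
  rw [hswap]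
  congr 1
  funext z
  rw [correlation, ← integral_const_mul]
  congr 1
  funext x
  ring

lemma energy_eq_correlation {φ ψ : Plane → ℝ} (hφ : IsTest φ) (hψ : IsTest ψ) :
    energy φ ψ = ∫ z, green z * correlation φ ψ z := by
  rw [← integral_mul_integral_mul_sub locallyIntegrable_green hφ hψ, energy]
  simp_rw [torusConv_eq_sub fun _ => hψ.eq_zero]

lemma integral_correlation {φ ψ : Plane → ℝ} (hφ : IsRadialTest φ) (hψ : IsRadialTest ψ) :
    ∫ z, correlation φ ψ z = 1 := by
  have h := integral_mul_integral_mul_sub (f := fun _ => 1) continuous_const.locallyIntegrable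
    hφ.toIsTest hψ.toIsTest
  simp only [one_mul, integral_sub_left_eq_self ψ, hψ.mass, mul_one, hφ.mass] at h
  exact h.symm

/-- The product difference telescopes into terms of order t⁻¹e^{−1/(32t)}, which stays bounded as t
→ 0. -/
lemma exists_heatKernel_sub_gauss_le : ∃ C > 0, ∀ t ∈ Set.Ioc (0 : ℝ) 1, ∀ z : Plane,
    (∀ i, |z i| ≤ 1 / 2) →
    |heatKernel t z - (4 * Real.pi * t)⁻¹ * Real.exp (-(z 0 ^ 2 + z 1 ^ 2) / (4 * t))| ≤ C := by
  obtain ⟨A, hA, hsub⟩ := exists_circleHeatKernel_sub_gauss_le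
  obtain ⟨B, hB, hbd⟩ := exists_circle_bounds
  refine ⟨A * (B + 1) * 32, by positivity, fun t ht z hz => ?_⟩
  have h0 := ht.1
  have hsq : √t * √t = t := Real.mul_self_sqrt h0.le
  set g : ℝ → ℝ := fun s => (√(4 * Real.pi * t))⁻¹ * Real.exp (-s ^ 2 / (4 * t)) with hg
  have hprod : (4 * Real.pi * t)⁻¹ * Real.exp (-(z 0 ^ 2 + z 1 ^ 2) / (4 * t)) =
      g (z 0) * g (z 1) := by
    simp only [hg]
    rw [mul_mul_mul_comm, ← Real.exp_add, ← mul_inv, Real.mul_self_sqrt (by positivity)]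
    congr 2
    ring
  have hg1 (s : ℝ) : |g s| ≤ (√t)⁻¹ := by
    rw [abs_of_nonneg (by positivity)]
    calc g s ≤ (√t)⁻¹ * 1 := by
          have h1 := inv_sqrt_four_pi_mul_le h0
          have h2 : Real.exp (-s ^ 2 / (4 * t)) ≤ 1 := by
            apply Real.exp_le_one_iff.2
            rw [neg_div]
            exact neg_nonpos.2 (by positivity)
          exact mul_le_mul h1 h2 (by positivity) (by positivity)
      _ = _ := mul_one _
  have hexp : t⁻¹ * Real.exp (-1 / (32 * t)) ≤ 32 := by
    have h1 := Real.add_one_le_exp (1 / (32 * t))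
    have h2 : (32 * t)⁻¹ ≤ Real.exp (1 / (32 * t)) := by
      rw [← one_div]; linarith
    rw [neg_div, Real.exp_neg, ← div_eq_mul_inv, div_le_iff₀ (Real.exp_pos _)]
    calc t⁻¹ = 32 * (32 * t)⁻¹ := by field_simp
      _ ≤ _ := by gcongr
  rw [hprod, heatKernel, Fin.prod_univ_two]
  have e : circleHeatKernel t (z 0) * circleHeatKernel t (z 1) - g (z 0) * g (z 1) =
      (circleHeatKernel t (z 0) - g (z 0)) * circleHeatKernel t (z 1) +
        g (z 0) * (circleHeatKernel t (z 1) - g (z 1)) := by ring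
  rw [e]
  refine (abs_add_le _ _).trans ?_
  rw [abs_mul, abs_mul]
  have hk : |circleHeatKernel t (z 1)| ≤ B * (√t)⁻¹ := by
    rw [abs_of_nonneg (circleHeatKernel_nonneg _ _)]
    exact (hbd t ht _).1
  calc _ ≤ (A * (√t)⁻¹ * Real.exp (-1 / (32 * t))) * (B * (√t)⁻¹) +
        (√t)⁻¹ * (A * (√t)⁻¹ * Real.exp (-1 / (32 * t))) := by
        gcongr
        · exact hsub t ht _ (hz 0)
        · exact hg1 _
        · exact hsub t ht _ (hz 1)
    _ = A * (B + 1) * (((√t) * √t)⁻¹ * Real.exp (-1 / (32 * t))) := by rw [mul_inv]; ring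
    _ ≤ A * (B + 1) * 32 := by rw [hsq]; gcongr

/-- The pairing of the heat kernel, with its mean removed, with a probability density supported
in a small square. -/
lemma exists_heat_pairing_bounds : ∃ C > 0, ∀ (η : Plane → ℝ) (l B : ℝ), 0 < l → l ≤ 1 / 2 →
    Measurable η → (∀ z, 0 ≤ η z) → (∀ z, |η z| ≤ B) → (∀ z ∉ box l, η z = 0) → ∫ z, η z = 1 →
    (∀ t ≥ 1, |∫ z, (heatKernel t z - 1) * η z| ≤ C * Real.exp (-t)) ∧
    (∀ t > 0, |∫ z, (heatKernel t z - 1) * η z| ≤ 4 * B + 1) ∧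
    ∀ t ∈ Set.Icc (l ^ 2) 1, |(∫ z, (heatKernel t z - 1) * η z) - (4 * Real.pi * t)⁻¹| ≤
      C + l ^ 2 * t⁻¹ ^ 2 := by
  obtain ⟨A, hA, hlarge⟩ := exists_large_time_plane_le
  obtain ⟨D, hD, hsmall⟩ := exists_heatKernel_sub_gauss_le
  refine ⟨A + D + 1, by positivity, fun η l B hl hl2 hm hnn hB hsupp hone => ?_⟩
  have hη : Integrable η := by
    by_contra h
    rw [integral_undef h] at hone
    exact zero_ne_one hone
  have hbound (f : Plane → ℝ) (K : ℝ) (h : ∀ z ∈ box l, |f z| ≤ K) : |∫ z, f z * η z| ≤ K := by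
    have h' := norm_integral_le_of_norm_le (f := fun z => f z * η z) (hη.const_mul K)
      (Eventually.of_forall fun z => ?_)
    · rwa [integral_const_mul, hone, mul_one] at h'
    · rw [norm_mul, Real.norm_of_nonneg (hnn z)]
      by_cases hz : z ∈ box l
      · exact mul_le_mul_of_nonneg_right (h z hz) (hnn z)
      · rw [hsupp z hz, mul_zero, mul_zero]
  have hsub (t c : ℝ) (ht : 0 < t) : Integrable fun z => (heatKernel t z - c) * η z := by
    have hi : IntegrableOn (fun z => heatKernel t z - c) (box l) :=
      integrableOn_box ((continuous_heatKernel ht).sub continuous_const) l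
    have h := hi.mul_bdd (c := B) (g := η) hm.aestronglyMeasurable
      (Eventually.of_forall fun z => hB z)
    rw [← IntegrableOn, integrableOn_iff_integrable_of_support_subset] at h
    · exact h
    · intro z hz
      by_contra hz'
      exact hz (by simp only [hsupp z hz', mul_zero])
  refine ⟨fun t ht => ?_, fun t ht => ?_, fun t ht => ?_⟩
  · refine (hbound _ _ fun z _ => (hlarge t ht z).1).trans ?_
    gcongr
    linarith
  · have hi0 : Integrable fun z => heatKernel t z * η z := by simpa using hsub t 0 ht
    have e : ∫ z, (heatKernel t z - 1) * η z = (∫ z, heatKernel t z * η z) - 1 := by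
      simp_rw [sub_mul, one_mul]
      rw [integral_sub hi0 hη, hone]
    -- `box 1` consists of four cells, on each of which the heat kernel has mass one.
    have h1 : ∫ z, heatKernel t z * η z ≤ 4 * B := by
      have hsub1 : box l ⊆ box (1 : ℕ) := box_mono (by push_cast; linarith)
      rw [← setIntegral_eq_integral_of_forall_compl_eq_zero (s := box (1 : ℕ))
        fun z hz => by rw [hsupp z fun h => hz (hsub1 h), mul_zero]]
      calc _ ≤ ∫ z in box (1 : ℕ), heatKernel t z * B := by
            refine integral_mono_ae hi0.integrableOn
              ((integrableOn_box (continuous_heatKernel ht) _).mul_const B)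
              (Eventually.of_forall fun z => ?_)
            exact mul_le_mul_of_nonneg_left ((le_abs_self _).trans (hB z)) (heatKernel_nonneg _ _)
        _ = 4 * B := by
            rw [integral_mul_const, setIntegral_heatKernel ht]
            norm_num
    have h2 : 0 ≤ ∫ z, heatKernel t z * η z :=
      integral_nonneg fun z => mul_nonneg (heatKernel_nonneg _ _) (hnn z)
    rw [e]
    have hB0 : 0 ≤ B := (abs_nonneg _).trans (hB 0)
    exact abs_le.2 ⟨by linarith, by linarith⟩
  · have h0 : 0 < t := lt_of_lt_of_le (by positivity) ht.1
    have e : (∫ z, (heatKernel t z - 1) * η z) - (4 * Real.pi * t)⁻¹ =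
        ∫ z, (heatKernel t z - 1 - (4 * Real.pi * t)⁻¹) * η z := by
      simp_rw [sub_mul _ ((4 * Real.pi * t)⁻¹)]
      rw [integral_sub (hsub t 1 h0) (hη.const_mul _), integral_const_mul, hone, mul_one]
    rw [e]
    refine hbound _ _ fun z hz => ?_
    have hz0 := hz 0
    have hz1 := hz 1
    have h1 := hsmall t ⟨h0, ht.2⟩ z fun i => abs_le.2
      ⟨by linarith [(hz i).1], by linarith [(hz i).2]⟩
    set E := Real.exp (-(z 0 ^ 2 + z 1 ^ 2) / (4 * t)) with hE
    have hE1 : E ≤ 1 := by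
      apply Real.exp_le_one_iff.2
      rw [neg_div]
      exact neg_nonpos.2 (by positivity)
    -- On the support |z|² ≤ 2ℓ². Multiplied by (4πt)⁻¹, the resulting error is the term ℓ²t⁻².
    have hE2 : 1 - l ^ 2 / (2 * t) ≤ E := by
      have h3 := Real.add_one_le_exp (-(z 0 ^ 2 + z 1 ^ 2) / (4 * t))
      have h4 : (z 0 ^ 2 + z 1 ^ 2) / (4 * t) ≤ l ^ 2 / (2 * t) := by
        rw [div_le_div_iff₀ (by positivity) (by positivity)]
        have : z 0 ^ 2 ≤ l ^ 2 := by nlinarith [hz0.1, hz0.2]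
        have : z 1 ^ 2 ≤ l ^ 2 := by nlinarith [hz1.1, hz1.2]
        nlinarith
      rw [neg_div] at h3
      rw [hE, neg_div]
      linarith
    have hpi : (4 * Real.pi * t)⁻¹ ≤ t⁻¹ := by
      gcongr
      nlinarith [Real.pi_gt_three]
    have h5 : |(4 * Real.pi * t)⁻¹ * E - (4 * Real.pi * t)⁻¹| ≤ l ^ 2 * t⁻¹ ^ 2 := by
      have h6 : 0 ≤ (4 * Real.pi * t)⁻¹ := by positivity
      rw [abs_sub_comm, abs_of_nonneg (by nlinarith)]
      calc _ = (4 * Real.pi * t)⁻¹ * (1 - E) := by ring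
        _ ≤ t⁻¹ * (l ^ 2 / (2 * t)) := by gcongr; linarith
        _ = l ^ 2 * t⁻¹ ^ 2 / 2 := by field_simp
        _ ≤ _ := by
          have : 0 ≤ l ^ 2 * t⁻¹ ^ 2 := by positivity
          linarith
    calc _ = |(heatKernel t z - (4 * Real.pi * t)⁻¹ * E) +
          ((4 * Real.pi * t)⁻¹ * E - (4 * Real.pi * t)⁻¹) - 1| := by congr 1; ring
      _ ≤ _ := by
        refine (abs_sub _ _).trans ?_
        have := abs_add_le (heatKernel t z - (4 * Real.pi * t)⁻¹ * E)
          ((4 * Real.pi * t)⁻¹ * E - (4 * Real.pi * t)⁻¹)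
        rw [abs_one]
        linarith

lemma rescale_eq_zero {θ : Plane → ℝ} (hθ : IsRadialDensity θ) {l : ℝ} (hl : 0 < l) {x : Plane}
    (hx : x ∉ box (l / 2)) : rescale l θ x = 0 := by
  rw [rescale, image_eq_zero_of_notMem_tsupport (f := θ), mul_zero]
  intro h
  refine hx fun i => ?_
  have h1 := hθ.support_subset h i
  simp only [PiLp.smul_apply, smul_eq_mul] at h1
  have h2 : x i = l * (l⁻¹ * x i) := by field_simp
  rw [h2]
  constructor <;> nlinarith [h1.1, h1.2]

lemma exists_rescale_le {θ : Plane → ℝ} (hθ : IsRadialDensity θ) :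
    ∃ M > 0, ∀ l > 0, ∀ x, |rescale l θ x| ≤ M * (l ^ 2)⁻¹ := by
  obtain ⟨M, hM⟩ := hθ.compact_support.exists_bound_of_continuous hθ.smooth.continuous
  refine ⟨max M 1, by positivity, fun l hl x => ?_⟩
  rw [rescale, abs_mul, abs_of_pos (by positivity), mul_comm]
  gcongr
  exact (hM _).trans (le_max_left _ _)

/-- Crude bound from local integrability of G and the sup norm of the correlation, used when ℓ stays
away from 0. -/
lemma exists_energy_le {θ χ : Plane → ℝ} (hθ : IsRadialDensity θ) (hχ : IsRadialDensity χ) :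
    ∃ C > 0, ∀ l ∈ Set.Ioo (0 : ℝ) 1,
      |energy (rescale l θ) (rescale l χ)| ≤ C * (l ^ 2)⁻¹ := by
  obtain ⟨M, hM, hMl⟩ := exists_rescale_le hχ
  have hg : IntegrableOn green (box 1) :=
    (locallyIntegrable_green.integrableOn_isCompact
      (isBounded_box 1).isCompact_closure).mono_set subset_closure
  refine ⟨(∫ z in box 1, |green z|) * M + 1, by positivity, fun l hl => ?_⟩
  have hθl := isRadialTest_rescale hθ hl
  have hχl := isRadialTest_rescale hχ hl
  have hz : ∀ z ∉ box 1, green z * correlation (rescale l θ) (rescale l χ) z = 0 := fun z hz => by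
    rw [correlation_eq_zero (R := 1 / 2) (S := 1 / 2) (fun _ => hθl.toIsTest.eq_zero)
      (fun _ => hχl.toIsTest.eq_zero) (by norm_num; exact hz), mul_zero]
  rw [energy_eq_correlation hθl.toIsTest hχl.toIsTest,
    ← setIntegral_eq_integral_of_forall_compl_eq_zero hz]
  have h := norm_integral_le_of_norm_le
    (f := fun z => green z * correlation (rescale l θ) (rescale l χ) z)
    (hg.abs.mul_const (M * (l ^ 2)⁻¹)) (Eventually.of_forall fun z => by
      rw [norm_mul]
      exact mul_le_mul_of_nonneg_left (abs_correlation_le hθl (hMl l hl.1) z) (norm_nonneg _))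
  rw [integral_mul_const] at h
  refine h.trans ?_
  have : 0 ≤ (l ^ 2)⁻¹ := by positivity
  nlinarith

/-- The time integral is cut at the diffusive scale ℓ² and at 1; only the middle range is unbounded
in ℓ. -/
lemma exists_energy_sub_log_le {θ χ : Plane → ℝ} (hθ : IsRadialDensity θ)
    (hχ : IsRadialDensity χ) : ∃ C > 0, ∀ l ∈ Set.Ioc (0 : ℝ) (1 / 2),
      |energy (rescale l θ) (rescale l χ) - (2 * Real.pi)⁻¹ * Real.log l⁻¹| ≤ C := by
  obtain ⟨M, hM, hMl⟩ := exists_rescale_le hχ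
  obtain ⟨C, hC, hpair⟩ := exists_heat_pairing_bounds
  refine ⟨(4 * M + 1) + (C + 1) + C, by positivity, fun l hl => ?_⟩
  have hl0 := hl.1
  have hl1 : l ∈ Set.Ioo (0 : ℝ) 1 := ⟨hl0, by linarith [hl.2]⟩
  have hl2 : l ^ 2 ≤ 1 := by nlinarith [hl.2]
  have hl2' : 0 < l ^ 2 := by positivity
  have hθl := isRadialTest_rescale hθ hl1
  have hχl := isRadialTest_rescale hχ hl1
  set η := correlation (rescale l θ) (rescale l χ) with hη
  have hm : StronglyMeasurable η := stronglyMeasurable_correlation hθl.continuous hχl.continuous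
  have hsupp : ∀ z ∉ box l, η z = 0 := fun z hz =>
    correlation_eq_zero (fun x hx => rescale_eq_zero hθ hl0 hx)
      (fun x hx => rescale_eq_zero hχ hl0 hx) (by rwa [add_halves])
  have hB : ∀ z, |η z| ≤ M * (l ^ 2)⁻¹ := abs_correlation_le hθl (hMl l hl0)
  obtain ⟨hw1, hw2, hw3⟩ := hpair η l (M * (l ^ 2)⁻¹) hl0 hl.2 hm.measurable
    (fun z => integral_nonneg fun x => mul_nonneg (hθl.nonneg _) (hχl.nonneg _)) hB hsupp
    (integral_correlation hθl hχl)
  set w : ℝ → ℝ := fun t => ∫ z, (heatKernel t z - 1) * η z with hw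
  obtain ⟨hwint, hwe⟩ := isTimeKernel_heatKernel_sub_one.integral_mul (φ := η)
    hm.aestronglyMeasurable hB (N := 1) fun z hz => hsupp z fun h =>
      hz (box_mono (by push_cast; linarith [hl.2]) h)
  have he : energy (rescale l θ) (rescale l χ) = ∫ t in Set.Ioi (0 : ℝ), w t :=
    (energy_eq_correlation hθl.toIsTest hχl.toIsTest).trans hwe
  have hi1 : IntegrableOn w (Set.Ioc 0 (l ^ 2)) := hwint.mono_set Set.Ioc_subset_Ioi_self
  have hi2 : IntegrableOn w (Set.Ioc (l ^ 2) 1) := hwint.mono_set fun t ht => hl2'.trans ht.1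
  have hi3 : IntegrableOn w (Set.Ioi 1) := hwint.mono_set (Set.Ioi_subset_Ioi zero_le_one)
  have hsplit : ∫ t in Set.Ioi (0 : ℝ), w t = (∫ t in Set.Ioc 0 (l ^ 2), w t) +
      (∫ t in Set.Ioc (l ^ 2) 1, w t) + ∫ t in Set.Ioi 1, w t := by
    rw [← setIntegral_union (Set.Ioc_disjoint_Ioc_of_le le_rfl) measurableSet_Ioc hi1 hi2,
      Set.Ioc_union_Ioc_eq_Ioc hl2'.le hl2, ← setIntegral_union Set.Ioc_disjoint_Ioi_same
        measurableSet_Ioi (hwint.mono_set Set.Ioc_subset_Ioi_self) hi3,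
      Set.Ioc_union_Ioi_eq_Ioi zero_le_one]
  -- The height O(ℓ⁻²) of the correlation is compensated by the length ℓ² of the interval.
  have hb1 : |∫ t in Set.Ioc 0 (l ^ 2), w t| ≤ 4 * M + 1 := by
    have h := norm_setIntegral_le_of_norm_le_const (μ := volume) (s := Set.Ioc 0 (l ^ 2))
      (f := w) (by simp) fun t ht => hw2 t ht.1
    rw [Real.volume_real_Ioc_of_le hl2'.le, sub_zero] at h
    refine h.trans ?_
    have : (4 * (M * (l ^ 2)⁻¹) + 1) * l ^ 2 = 4 * M + l ^ 2 := by field_simp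
    linarith
  have hb3 : |∫ t in Set.Ioi 1, w t| ≤ C := by
    have h := norm_integral_le_of_norm_le (f := w) (μ := volume.restrict (Set.Ioi 1))
      (g := fun t => C * Real.exp (-t)) ((integrableOn_exp_neg_Ioi 1).const_mul C) (by
        filter_upwards [ae_restrict_mem measurableSet_Ioi] with t ht using hw1 t ht.le)
    rw [integral_const_mul, integral_exp_neg_Ioi] at h
    refine h.trans ?_
    have : Real.exp (-1) ≤ 1 := Real.exp_le_one_iff.2 (by norm_num)
    nlinarith
  have h0mem : (0 : ℝ) ∉ Set.uIcc (l ^ 2) 1 := by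
    rw [Set.uIcc_of_le hl2]
    exact fun h => absurd h.1 (not_le.2 hl2')
  have hinv : IntegrableOn (fun t : ℝ => (4 * Real.pi * t)⁻¹) (Set.Ioc (l ^ 2) 1) := by
    rw [← intervalIntegrable_iff_integrableOn_Ioc_of_le hl2]
    refine ContinuousOn.intervalIntegrable (ContinuousOn.inv₀ (by fun_prop) fun t ht => ?_)
    have : t ≠ 0 := fun h => h0mem (h ▸ ht)
    have := Real.pi_ne_zero
    positivity
  have hlog : ∫ t in Set.Ioc (l ^ 2) 1, (4 * Real.pi * t)⁻¹ = (2 * Real.pi)⁻¹ * Real.log l⁻¹ := by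
    rw [← intervalIntegral.integral_of_le hl2]
    simp_rw [mul_inv (4 * Real.pi)]
    rw [intervalIntegral.integral_const_mul, integral_inv h0mem, one_div, ← inv_pow, Real.log_pow]
    push_cast
    field_simp
    norm_num
  have hderiv : ∀ t ∈ Set.uIcc (l ^ 2) 1, HasDerivAt (fun t : ℝ => -t⁻¹) (t⁻¹ ^ 2) t :=
    fun t ht => by
      have ht0 : t ≠ 0 := fun h => h0mem (h ▸ ht)
      refine (hasDerivAt_inv ht0).neg.congr_deriv ?_
      rw [neg_neg, inv_pow]
  have hinv2 : ∫ t in Set.Ioc (l ^ 2) 1, l ^ 2 * t⁻¹ ^ 2 ≤ 1 := by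
    rw [← intervalIntegral.integral_of_le hl2, intervalIntegral.integral_const_mul,
      intervalIntegral.integral_eq_sub_of_hasDerivAt (f := fun t : ℝ => -t⁻¹) hderiv ?_]
    · have : l ^ 2 * (-1⁻¹ - -(l ^ 2)⁻¹) = 1 - l ^ 2 := by field_simp; ring
      rw [this]
      linarith
    · refine ContinuousOn.intervalIntegrable (ContinuousOn.pow (ContinuousOn.inv₀ (by fun_prop)
        fun t ht h => h0mem (h ▸ ht)) 2)
  have hint2 : IntegrableOn (fun t : ℝ => l ^ 2 * t⁻¹ ^ 2) (Set.Ioc (l ^ 2) 1) := by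
    rw [← intervalIntegrable_iff_integrableOn_Ioc_of_le hl2]
    exact ContinuousOn.intervalIntegrable (continuousOn_const.mul (ContinuousOn.pow
      (ContinuousOn.inv₀ (by fun_prop) fun t ht h => h0mem (h ▸ ht)) 2))
  have hb2 : |(∫ t in Set.Ioc (l ^ 2) 1, w t) - (2 * Real.pi)⁻¹ * Real.log l⁻¹| ≤ C + 1 := by
    rw [← hlog, ← integral_sub hi2 hinv]
    have h := norm_integral_le_of_norm_le (f := fun t => w t - (4 * Real.pi * t)⁻¹)
      (μ := volume.restrict (Set.Ioc (l ^ 2) 1)) (g := fun t => C + l ^ 2 * t⁻¹ ^ 2)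
      (Integrable.fun_add (integrable_const C) hint2) (by
        filter_upwards [ae_restrict_mem measurableSet_Ioc] with t ht
        exact hw3 t ⟨ht.1.le, ht.2⟩)
    rw [integral_add (integrable_const C) hint2] at h
    simp only [integral_const, measureReal_restrict_apply_univ, smul_eq_mul] at h
    rw [Real.volume_real_Ioc_of_le hl2] at h
    refine h.trans ?_
    nlinarith
  rw [he, hsplit]
  have e : (∫ t in Set.Ioc 0 (l ^ 2), w t) + (∫ t in Set.Ioc (l ^ 2) 1, w t) +
      (∫ t in Set.Ioi 1, w t) - (2 * Real.pi)⁻¹ * Real.log l⁻¹ =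
      (∫ t in Set.Ioc 0 (l ^ 2), w t) + ((∫ t in Set.Ioc (l ^ 2) 1, w t) -
        (2 * Real.pi)⁻¹ * Real.log l⁻¹) + ∫ t in Set.Ioi 1, w t := by ring
  rw [e]
  refine (abs_add_three _ _ _).trans ?_
  gcongr

lemma tendsto_log_inv_nhdsGT : Tendsto (fun l : ℝ => Real.log l⁻¹) (𝓝[>] 0) atTop :=
  Real.tendsto_log_atTop.comp tendsto_inv_nhdsGT_zero

lemma tendsto_energy {θ : Plane → ℝ} (hθ : IsRadialDensity θ) :
    Tendsto (fun l => energy (rescale l θ) (rescale l θ)) (𝓝[>] 0) atTop := by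
  obtain ⟨C, hC, h⟩ := exists_energy_sub_log_le hθ hθ
  refine tendsto_atTop_mono' _ ?_ (tendsto_atTop_add_const_right _ (-C)
    (tendsto_log_inv_nhdsGT.const_mul_atTop (r := (2 * Real.pi)⁻¹) (by positivity)))
  filter_upwards [Ioc_mem_nhdsGT (one_half_pos (α := ℝ))] with l hl
  linarith [(abs_le.1 (h l hl)).1]

/-- Both energies have the same logarithmic leading term, so they differ by O(1) while the
denominator diverges. -/
lemma tendsto_energy_div {θ χ ψ : Plane → ℝ} (hθ : IsRadialDensity θ) (hχ : IsRadialDensity χ)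
    (hψ : IsRadialDensity ψ) :
    Tendsto (fun l => energy (rescale l θ) (rescale l χ) / energy (rescale l ψ) (rescale l ψ))
      (𝓝[>] 0) (𝓝 1) := by
  obtain ⟨C, hC, h⟩ := exists_energy_sub_log_le hθ hχ
  obtain ⟨C', hC', h'⟩ := exists_energy_sub_log_le hψ hψ
  have hlim := tendsto_energy hψ
  have h0 : Tendsto (fun l => (energy (rescale l θ) (rescale l χ) -
      energy (rescale l ψ) (rescale l ψ)) / energy (rescale l ψ) (rescale l ψ))
      (𝓝[>] 0) (𝓝 0) := by
    refine squeeze_zero_norm' ?_ (hlim.const_div_atTop (C + C'))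
    filter_upwards [Ioc_mem_nhdsGT (one_half_pos (α := ℝ)), hlim.eventually_gt_atTop 0]
      with l hl hpos
    rw [norm_div, Real.norm_eq_abs, Real.norm_of_nonneg hpos.le]
    gcongr
    have h1 := abs_le.1 (h l hl)
    have h2 := abs_le.1 (h' l hl)
    exact abs_le.2 ⟨by linarith, by linarith⟩
  have h1 := h0.add_const 1
  rw [zero_add] at h1
  refine h1.congr' ?_
  filter_upwards [hlim.eventually_gt_atTop 0] with l hpos
  field_simp
  ring

/-! ### Smoothness and derivatives of torus correlations. -/

/-- The correlation `a ↦ ∫ f(a - w) g(-w) dw` of two functions on the torus. -/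
def torusCorr (f g : Plane → ℝ) (a : Plane) : ℝ := ∫ w in cell, f (a - w) * g (-w)

/-- Near any a the correlation is a convolution with a compactly supported smooth function, obtained
by cutting f off far away. -/
lemma contDiff_torusCorr {f g : Plane → ℝ} (hf : ContDiff ℝ ∞ f) (hg : Continuous g) :
    ContDiff ℝ ∞ (torusCorr f g) := by
  rw [contDiff_iff_contDiffAt]
  intro a
  -- For ‖b − a‖ < 1 and w in the cell, ‖b − w‖ ≤ ‖a‖ + 2, so the cutoff equals 1 wherever f is
  -- evaluated.
  let ρ : ContDiffBump (0 : Plane) := ⟨‖a‖ + 3, ‖a‖ + 4, by positivity, by linarith⟩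
  have hk : LocallyIntegrable ((box (1 / 2)).indicator fun w => g (-w)) :=
    ((integrable_indicator_iff (measurableSet_box _)).2
      (integrableOn_box (hg.comp continuous_neg) _)).locallyIntegrable
  have hcd : ContDiff ℝ ∞ (convolution ((box (1 / 2)).indicator fun w => g (-w))
      (fun x => ρ x * f x) (ContinuousLinearMap.mul ℝ ℝ) volume) :=
    (ρ.hasCompactSupport.mul_right).contDiff_convolution_right _ hk (ρ.contDiff.mul hf)
  refine hcd.contDiffAt.congr_of_eventuallyEq ?_
  filter_upwards [Metric.ball_mem_nhds a one_pos] with b hb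
  rw [torusCorr, setIntegral_cell, ← integral_indicator (measurableSet_box _), convolution]
  congr 1
  funext w
  by_cases hw : w ∈ box (1 / 2)
  · rw [Set.indicator_of_mem hw, Set.indicator_of_mem hw, ContinuousLinearMap.mul_apply',
      ρ.one_of_mem_closedBall, one_mul, mul_comm]
    have h1 := norm_le_of_mem_box hw
    have h2 := mem_ball_iff_norm.1 hb
    have h3 := norm_sub_le b w
    have h4 := norm_le_norm_add_norm_sub' b a
    rw [mem_closedBall_zero_iff]
    change _ ≤ ‖a‖ + 3
    linarith
  · rw [Set.indicator_of_notMem hw, Set.indicator_of_notMem hw]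
    simp

lemma pderiv_torusCorr {f g : Plane → ℝ} (hf : IsSmoothPeriodic f) (hg : Continuous g)
    (j : Fin 2) : pderiv j (torusCorr f g) = torusCorr (pderiv j f) g := by
  funext a
  refine HasLineDerivAt.lineDeriv (𝕜 := ℝ) (v := unitVec j) ?_
  have hc := (hf.pderiv j).continuous
  have hfc := hf.continuous
  obtain ⟨M, hM⟩ := (isCompact_closedBall (0 : Plane) (‖a‖ + 2)).exists_bound_of_continuousOn
    hc.continuousOn
  have key := (hasDerivAt_integral_of_dominated_loc_of_deriv_le (𝕜 := ℝ)
    (μ := volume.restrict (box (1 / 2))) (x₀ := (0 : ℝ)) (s := Metric.ball 0 1)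
    (F := fun r w => f (a - w + r • unitVec j) * g (-w))
    (F' := fun r w => pderiv j f (a - w + r • unitVec j) * g (-w))
    (bound := fun w => M * |g (-w)|) (Metric.ball_mem_nhds _ one_pos)
    (Eventually.of_forall fun r => (by fun_prop : Continuous _).aestronglyMeasurable)
    (integrableOn_box (by fun_prop) _) (by fun_prop : Continuous _).aestronglyMeasurable ?_
    ((integrableOn_box (by fun_prop : Continuous fun w => |g (-w)|) _).const_mul M) ?_).2
  · unfold HasLineDerivAt
    simp only [torusCorr, setIntegral_cell]
    simp only [zero_smul, add_zero] at key
    simpa only [add_sub_right_comm] using key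
  · filter_upwards [ae_restrict_mem (measurableSet_box _)] with w hw r hr
    rw [norm_mul]
    refine mul_le_mul_of_nonneg_right (hM _ ?_) (norm_nonneg _)
    rw [mem_closedBall_zero_iff]
    have h1 := norm_le_of_mem_box hw
    have h2 := norm_add_le (a - w) (r • unitVec j)
    have h3 := norm_sub_le a w
    have h4 : ‖r • unitVec j‖ ≤ 1 := by
      rw [norm_smul, unitVec, PiLp.norm_single, norm_one, mul_one]
      exact (mem_ball_zero_iff.1 hr).le
    linarith
  · exact Eventually.of_forall fun w r _ => (hf.hasDerivAt j _ r).mul_const _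

/-! ### Covariance of the vortex field. -/

section Vortex

variable {κ : ℝ} {θ χ : Plane → ℝ} {γ : ℝ → ℝ} {l : ℝ}

/-- The sign with which `∂_{1-i} G` enters the `i`-th component of the Biot-Savart kernel. -/
def biotSavartSign (i : Fin 2) : ℝ := ![-1, 1] i

lemma vortex_horizontal (hθ : IsTest (rescale l θ)) (i : Fin 2) (x : Plane) :
    vortex κ θ χ γ l x i.castSucc =
      (intensity κ θ l * biotSavartSign i) *
        pderiv i.rev (torusConv green (rescale l θ)) x := by
  fin_cases i
  · change intensity κ θ l * torusConv (biotSavart 0) (rescale l θ) x =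
      (intensity κ θ l * (-1)) * pderiv 1 (torusConv green (rescale l θ)) x
    rw [torusConv_biotSavart_zero hθ]
    ring
  · change intensity κ θ l * torusConv (biotSavart 1) (rescale l θ) x =
      (intensity κ θ l * 1) * pderiv 0 (torusConv green (rescale l θ)) x
    rw [torusConv_biotSavart_one hθ, mul_one]

lemma vortex_vertical (x : Plane) :
    vortex κ θ χ γ l x 2 = γ l * torusConv green (rescale l χ) x := rfl

lemma intensity_sq (hκ : 0 < κ) (hθ : IsRadialTest (rescale l θ)) :
    intensity κ θ l ^ 2 = 4 * κ / energy (rescale l θ) (rescale l θ) := by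
  rw [intensity, velocityNorm_eq hθ, mul_pow, mul_pow, inv_pow, Real.sq_sqrt hκ.le,
    Real.sq_sqrt hθ.energy_self_pos.le]
  ring

lemma intensity_pos (hκ : 0 < κ) (hθ : IsRadialTest (rescale l θ)) : 0 < intensity κ θ l := by
  have := Real.sqrt_pos.2 hθ.energy_self_pos
  rw [intensity, velocityNorm_eq hθ]
  positivity

/-- The gradient components are orthogonal with square integral E/2 each; multiplying by Γ² = 4κ/E
gives 2κ. The two minus signs from parity cancel. -/
lemma covH_zero (hκ : 0 < κ) (hθ : IsRadialTest (rescale l θ)) :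
    covH (vortex κ θ χ γ l) 0 = (2 * κ) • (1 : Matrix (Fin 2) (Fin 2) ℝ) := by
  ext i j
  have h : covH (vortex κ θ χ γ l) 0 i j = ∫ w in cell,
      vortex κ θ χ γ l (0 - w) i.castSucc * vortex κ θ χ γ l (-w) j.castSucc := rfl
  have hterm (w : Plane) :
      vortex κ θ χ γ l (0 - w) i.castSucc * vortex κ θ χ γ l (-w) j.castSucc =
      (intensity κ θ l ^ 2 * (biotSavartSign i * biotSavartSign j)) *
        (pderiv i.rev (torusConv green (rescale l θ)) w *
          pderiv j.rev (torusConv green (rescale l θ)) w) := by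
    rw [vortex_horizontal hθ.toIsTest, vortex_horizontal hθ.toIsTest, zero_sub, hθ.pderiv_neg,
      hθ.pderiv_neg]
    ring
  simp_rw [h, hterm]
  rw [integral_const_mul, setIntegral_cell, hθ.setIntegral_pderiv_mul_pderiv hθ,
    intensity_sq hκ hθ, Matrix.smul_apply, Matrix.one_apply]
  have hE := hθ.energy_self_pos.ne'
  have hs : biotSavartSign i * biotSavartSign i = 1 := by
    fin_cases i <;> simp [biotSavartSign]
  by_cases hij : i = j
  · subst hij
    rw [if_pos rfl, if_pos rfl, hs, smul_eq_mul]
    field_simp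
    norm_num
  · rw [if_neg hij, if_neg fun h => hij (Fin.rev_injective h)]
    simp

lemma covH3_eq (hθ : IsRadialTest (rescale l θ)) (i : Fin 2) :
    covH3 (vortex κ θ χ γ l) i = fun a => (intensity κ θ l * biotSavartSign i * γ l) *
      torusCorr (pderiv i.rev (torusConv green (rescale l θ)))
        (torusConv green (rescale l χ)) a := by
  funext a
  rw [torusCorr, ← integral_const_mul]
  refine integral_congr_ae (Eventually.of_forall fun w => ?_)
  simp only [vortex_horizontal hθ.toIsTest, vortex_vertical]
  ring

lemma cov3_eq : cov3 (vortex κ θ χ γ l) = fun a => γ l ^ 2 *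
    torusCorr (torusConv green (rescale l χ)) (torusConv green (rescale l χ)) a := by
  funext a
  rw [torusCorr, ← integral_const_mul]
  refine integral_congr_ae (Eventually.of_forall fun w => ?_)
  simp only [vortex_vertical]
  ring

lemma pderiv_const_mul (c : ℝ) (f : Plane → ℝ) (i : Fin 2) :
    pderiv i (fun a => c * f a) = fun a => c * pderiv i f a := by
  funext a
  exact deriv_const_mul_field c

lemma torusCorr_pderiv_pderiv_zero {φ ψ : Plane → ℝ} (hφ : IsRadialTest φ) (hψ : IsRadialTest ψ)
    (i j : Fin 2) :
    torusCorr (pderiv j (pderiv i (torusConv green φ))) (torusConv green ψ) 0 =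
      if i = j then -(energy φ ψ) / 2 else 0 := by
  simp only [torusCorr, zero_sub, hφ.pderiv_pderiv_neg, hψ.torusConv_neg, setIntegral_cell]
  split_ifs with h
  · rw [← h, hφ.setIntegral_pure hψ]
  · exact hφ.setIntegral_mixed hψ h

/-- The ith velocity component carries the derivative in the other direction, so only the
off-diagonal entries survive, each ±ΓγE(θ_ℓ, χ_ℓ)/2. Substituting Γ² = 4κ/E(θ_ℓ, θ_ℓ) exposes the
two ratios that have limits. -/
lemma gradCovH3_eq (hκ : 0 < κ) (hθ : IsRadialTest (rescale l θ))
    (hχ : IsRadialTest (rescale l χ)) :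
    gradCovH3 (vortex κ θ χ γ l) = (2 * κ * (γ l / intensity κ θ l) *
      (energy (rescale l θ) (rescale l χ) / energy (rescale l θ) (rescale l θ))) •
        !![0, 1; -1, 0] := by
  have hΓ := (intensity_pos hκ hθ).ne'
  have hE := hθ.energy_self_pos.ne'
  have hsq := intensity_sq hκ hθ
  have hcoef : 2 * κ * (γ l / intensity κ θ l) * (energy (rescale l θ) (rescale l χ) /
      energy (rescale l θ) (rescale l θ)) =
      intensity κ θ l * γ l * energy (rescale l θ) (rescale l χ) / 2 := by
    rw [eq_div_iff hE] at hsq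
    field_simp
    linear_combination (-(γ l * energy (rescale l θ) (rescale l χ))) * hsq
  have hentry (i j : Fin 2) : gradCovH3 (vortex κ θ χ γ l) i j =
      (intensity κ θ l * biotSavartSign i * γ l) *
        if i.rev = j then -(energy (rescale l θ) (rescale l χ)) / 2 else 0 := by
    change pderiv j (covH3 (vortex κ θ χ γ l) i) 0 = _
    rw [covH3_eq hθ, pderiv_const_mul, pderiv_torusCorr (hθ.periodic.pderiv _)
      hχ.periodic.continuous]
    beta_reduce
    rw [torusCorr_pderiv_pderiv_zero hθ hχ]
  ext i j
  rw [hcoef, hentry]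
  fin_cases i <;> fin_cases j <;> simp [biotSavartSign] <;> ring

/-- Both derivatives fall on the first factor, and the energy identities leave a multiple of the
identity; any seminorm of it is then controlled by γ²E(χ_ℓ, χ_ℓ). -/
lemma hessCov3_eq (hχ : IsRadialTest (rescale l χ)) :
    hessCov3 (vortex κ θ χ γ l) =
      (-(γ l ^ 2 * energy (rescale l χ) (rescale l χ)) / 2) •
        (1 : Matrix (Fin 2) (Fin 2) ℝ) := by
  ext i j
  change pderiv i (pderiv j (cov3 (vortex κ θ χ γ l))) 0 = _
  rw [cov3_eq, pderiv_const_mul, pderiv_const_mul, pderiv_torusCorr hχ.periodic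
      hχ.periodic.continuous, pderiv_torusCorr (hχ.periodic.pderiv _) hχ.periodic.continuous]
  beta_reduce
  rw [torusCorr_pderiv_pderiv_zero hχ hχ, Matrix.smul_apply, Matrix.one_apply, smul_eq_mul]
  by_cases h : i = j
  · rw [if_pos h, if_pos h.symm]
    ring
  · rw [if_neg h, if_neg fun h' => h h'.symm]
    ring

lemma tendsto_gradCovH3 (hκ : 0 < κ) (hθ : IsRadialDensity θ) (hχ : IsRadialDensity χ) {q : ℝ}
    (hq : Tendsto (fun l => γ l / intensity κ θ l) (𝓝[>] 0) (𝓝 q)) :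
    Tendsto (fun l => gradCovH3 (vortex κ θ χ γ l)) (𝓝[>] 0)
      (𝓝 ((2 * κ * q) • !![0, 1; -1, 0])) := by
  have h := ((hq.const_mul (2 * κ)).mul (tendsto_energy_div hθ hχ hθ)).smul_const
    (!![0, 1; -1, 0] : Matrix (Fin 2) (Fin 2) ℝ)
  rw [mul_one] at h
  refine h.congr' ?_
  filter_upwards [Ioo_mem_nhdsGT one_pos] with l hl
  exact (gradCovH3_eq hκ (isRadialTest_rescale hθ hl) (isRadialTest_rescale hχ hl)).symm

lemma seminorm_hessCov3_eq (hχ : IsRadialTest (rescale l χ))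
    (N : Seminorm ℝ (Matrix (Fin 2) (Fin 2) ℝ)) :
    N (hessCov3 (vortex κ θ χ γ l)) =
      γ l ^ 2 * energy (rescale l χ) (rescale l χ) / 2 * N 1 := by
  have := hχ.energy_self_pos
  rw [hessCov3_eq hχ, map_smul_eq_mul, neg_div, norm_neg, Real.norm_of_nonneg (by positivity)]

/-- From γ² ≤ c²Γ² = 4κc²/E(θ_ℓ, θ_ℓ), the divergence of E(χ_ℓ, χ_ℓ) is cancelled by that of E(θ_ℓ,
θ_ℓ). -/
lemma exists_forall_hessCov3_le (hκ : 0 < κ) (hθ : IsRadialDensity θ) (hχ : IsRadialDensity χ)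
    (hγ : γ =O[𝓝[>] 0] intensity κ θ) (N : Seminorm ℝ (Matrix (Fin 2) (Fin 2) ℝ)) :
    ∃ δ ∈ Set.Ioo (0 : ℝ) 1,
      BddAbove ((fun l => N (hessCov3 (vortex κ θ χ γ l))) '' Set.Ioo 0 δ) := by
  obtain ⟨c, hc⟩ := hγ.bound
  have hev : ∀ᶠ l in 𝓝[>] (0 : ℝ), N (hessCov3 (vortex κ θ χ γ l)) ≤ c ^ 2 * (4 * κ) * N 1 := by
    -- The energy ratio tends to 1; the threshold 2 is chosen to cancel the factor 1/2 of the
    -- Hessian.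
    filter_upwards [hc, Ioo_mem_nhdsGT one_pos,
      (tendsto_energy_div hχ hχ hθ).eventually_lt_const one_lt_two] with l hl hl1 hratio
    have hθl := isRadialTest_rescale hθ hl1
    have hχl := isRadialTest_rescale hχ hl1
    have hE := hθl.energy_self_pos
    have hE' := hχl.energy_self_pos
    rw [seminorm_hessCov3_eq hχl]
    refine mul_le_mul_of_nonneg_right ?_ (apply_nonneg N 1)
    have h1 : γ l ^ 2 ≤ c ^ 2 * (4 * κ / energy (rescale l θ) (rescale l θ)) := by
      rw [← intensity_sq hκ hθl, ← mul_pow, ← sq_abs]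
      rw [Real.norm_eq_abs, Real.norm_of_nonneg (intensity_pos hκ hθl).le] at hl
      gcongr
    calc _ ≤ c ^ 2 * (4 * κ / energy (rescale l θ) (rescale l θ)) *
          energy (rescale l χ) (rescale l χ) / 2 := by gcongr
      _ = c ^ 2 * (4 * κ) * ((energy (rescale l χ) (rescale l χ) /
          energy (rescale l θ) (rescale l θ)) / 2) := by ring
      _ ≤ c ^ 2 * (4 * κ) * (2 / 2) := by gcongr
      _ = _ := by ring
  obtain ⟨δ, hδ, hsub⟩ := mem_nhdsGT_iff_exists_Ioo_subset.1 hev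
  refine ⟨min δ (1 / 2), ⟨lt_min hδ (by norm_num), (min_le_right _ _).trans_lt (by norm_num)⟩,
    c ^ 2 * (4 * κ) * N 1, ?_⟩
  rintro _ ⟨l, hl, rfl⟩
  exact hsub ⟨hl.1, hl.2.trans_le (min_le_left _ _)⟩

lemma bddAbove_hessCov3_Ico (hχ : IsRadialDensity χ)
    (N : Seminorm ℝ (Matrix (Fin 2) (Fin 2) ℝ)) {δ : ℝ} (hδ : 0 < δ)
    (hγ : BddAbove ((fun l => |γ l|) '' Set.Ico δ 1)) :
    BddAbove ((fun l => N (hessCov3 (vortex κ θ χ γ l))) '' Set.Ico δ 1) := by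
  obtain ⟨g, hg⟩ := hγ
  obtain ⟨C, hC, hE⟩ := exists_energy_le hχ hχ
  refine ⟨g ^ 2 * (C * (δ ^ 2)⁻¹) / 2 * N 1, ?_⟩
  rintro _ ⟨l, hl, rfl⟩
  have hl1 : l ∈ Set.Ioo (0 : ℝ) 1 := ⟨hδ.trans_le hl.1, hl.2⟩
  have hχl := isRadialTest_rescale hχ hl1
  have hE' := hχl.energy_self_pos
  have hgl : |γ l| ≤ g := hg ⟨l, hl, rfl⟩
  simp only
  rw [seminorm_hessCov3_eq hχl]
  refine mul_le_mul_of_nonneg_right ?_ (apply_nonneg N 1)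
  have h1 : γ l ^ 2 ≤ g ^ 2 := by rw [← sq_abs]; gcongr
  have h2 : energy (rescale l χ) (rescale l χ) ≤ C * (δ ^ 2)⁻¹ := by
    refine (le_abs_self _).trans ((hE l hl1).trans ?_)
    have := hl.1
    gcongr
  gcongr

end Vortex

end VortexNoise

end

theorem mainTheorem3 (κ : ℝ) (hκ : 0 < κ) (θ χ : Plane → ℝ)
    (hθ : IsRadialDensity θ) (hχ : IsRadialDensity χ) (γ : ℝ → ℝ) :
    -- the covariance functions are smooth and the horizontal one is normalised
    (∀ l ∈ Set.Ioo (0 : ℝ) 1,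
      0 < intensity κ θ l ∧
      covH (vortex κ θ χ γ l) 0 = (2 * κ) • (1 : Matrix (Fin 2) (Fin 2) ℝ) ∧
      (∀ i, ContDiff ℝ ∞ (covH3 (vortex κ θ χ γ l) i)) ∧
      ContDiff ℝ ∞ (cov3 (vortex κ θ χ γ l))) ∧
    -- (1)
    (γ =o[𝓝[>] 0] intensity κ θ →
      Tendsto (fun l => gradCovH3 (vortex κ θ χ γ l)) (𝓝[>] 0) (𝓝 0)) ∧
    -- (2)
    (∀ q₀ : ℝ, q₀ ≠ 0 → Tendsto (fun l => γ l / intensity κ θ l) (𝓝[>] 0) (𝓝 q₀) →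
      Tendsto (fun l => gradCovH3 (vortex κ θ χ γ l)) (𝓝[>] 0)
        (𝓝 ((2 * κ * q₀) • !![0, 1; -1, 0]))) ∧
    -- (3)
    (γ =O[𝓝[>] 0] intensity κ θ → ∀ N : Seminorm ℝ (Matrix (Fin 2) (Fin 2) ℝ),
      (∃ δ ∈ Set.Ioo (0 : ℝ) 1,
        BddAbove ((fun l => N (hessCov3 (vortex κ θ χ γ l))) '' Set.Ioo 0 δ)) ∧
      ((∀ δ ∈ Set.Ioo (0 : ℝ) 1, BddAbove ((fun l => |γ l|) '' Set.Ico δ 1)) →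
        BddAbove ((fun l => N (hessCov3 (vortex κ θ χ γ l))) '' Set.Ioo 0 1))) := by
  refine ⟨fun l hl => ?_, fun hγ => ?_, fun q₀ _ hq => tendsto_gradCovH3 hκ hθ hχ hq,
    fun hγ N => ?_⟩
  · have hθl := isRadialTest_rescale hθ hl
    have hχl := isRadialTest_rescale hχ hl
    refine ⟨intensity_pos hκ hθl, covH_zero hκ hθl, fun i => ?_, ?_⟩
    · rw [covH3_eq hθl]
      exact contDiff_const.mul (contDiff_torusCorr (hθl.periodic.pderiv _).smooth
        hχl.periodic.continuous)
    · rw [cov3_eq]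
      exact contDiff_const.mul (contDiff_torusCorr hχl.periodic.smooth hχl.periodic.continuous)
  -- The small-o case is the limit formula at q = 0.
  · simpa using tendsto_gradCovH3 hκ hθ hχ hγ.tendsto_div_nhds_zero
  · obtain ⟨δ, hδ, hbdd⟩ := exists_forall_hessCov3_le hκ hθ hχ hγ N
    refine ⟨⟨δ, hδ, hbdd⟩, fun hloc => ?_⟩
    -- The asymptotic bound covers (0, δ) and the crude energy bound covers [δ, 1).
    refine (hbdd.union (bddAbove_hessCov3_Ico (θ := θ) (κ := κ) hχ N hδ.1 (hloc δ hδ))).mono ?_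
    rw [← Set.image_union, Set.Ioo_union_Ico_eq_Ioo hδ.1 hδ.2.le]
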